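/- Let $p$ be a prime and let $G$ be the Vilenkin group of all sequences $x=(x_k)_{k\in\mathbb Z}$ with $x_k\in\mathbb Z/p$ and only finitely many nonzero $x_k$ with $k<0$, under coordinatewise addition, with the subgroups $G_n=\{x: x_k=0 \text{ for } k<n\}$ as a base of neighbourhoods of $0$ and with Haar measure $\mu$, $\mu(G_0)=1$. Let $X$ be the group of continuous characters of $G$, let $G_n^\perp\subset X$ be the annihilator of $G_n$; give $X$ the topology whose base consists of the cosets of the $G_n^\perp$, and the Haar measure $\nu$ with $\nu(G_0^\perp)=1$. Write $(\mathcal A x)_k=x_{k+1}$, $(\chi\mathcal A^n)(x)=\chi(\mathcal A^n x)$ for $n\in\mathbb Z$, and $H_0=\{h\in G: h_k=0\text{ for }k\ge 0\}$. Fix characters $r_n\in G_{n+1}^\perp\setminus G_n^\perp$ with $r_n\mathcal A=r_{n+1}$ $(n\in\mathbb Z)$. The Fourier transform of $f\in L_2(G)$ is $\hat f(\chi)=\lim_{n\to\infty}\int_{G_{-n}}f(x)\overline{\chi(x)}\,d\mu(x)$, the limit being in $L_2(X)$. Let $N\ge 1$. A rooted tree $T$ with vertices labelled by $\{0,\dots,p-1\}$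 (the root has level $0$) is *$N$-valid* if the root and all vertices of levels $1,\dots,N-1$ are labelled $0$ and every word of $N$ labels is carried by exactly one path of $N$ vertices in $T$ (a path runs from a vertex to its parent and so on, towards the root). Let $\Gamma$ be the directed graph on the vertices of $T$ whose edges are those from each vertex to its parent, together with the edges from $v$ to $w$ whenever $v$ has level at least $N$, $w$ has a smaller level than $v$, and the path of $N-1$ vertices that starts at $w$ exists and carries the same labels as the path of $N-1$ vertices that starts at the parent of $v$. Put $\lambda_{\alpha_{-N},\dots,\alpha_0}=1$ if all $\alpha_i=0$ or if $(\alpha_{-N},\dots,\alpha_0)$ is the sequence of labels of a directed path in $\Gamma$, and $\lambda_{\alpha_{-N},\dots,\alpha_0}=0$ otherwise. Define the mask $m_0$ on $X$ by $$m_0\bigl(G_{-N}^\perp r_{-N}^{\alpha_{-N}}\cdots r_0^{\alpha_0}\,r_1^{\beta_1}\cdots r_l^{\beta_l}\bigr)=\lambda_{\alpha_{-N},\dots,\alpha_0}\qquad(l\ge 0,\ \alpha_i,\beta_i\in\{0,\dots,p-1\})$$ and put $\hat\varphi(\chi)=\prod_{k=0}^\infty m_0(\chi\mathcal A^{-k})$.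 **Theorem.** Let $T$ be an $N$-valid tree in which the set of labels of the vertices of level $N$ is $\{1,\dots,p-1\}$. Then $\hat\varphi$ is the Fourier transform of a function $\varphi\in L_2(G)$. Moreover, for every partition $\{1,\dots,p-1\}=J_1\sqcup J_2$ (one part may be empty), consider the finitely many cosets $$G_{-N+1}^\perp r_{-N+1}^{k}\ (k\in J_1),\qquad G_{-N}^\perp r_{-N}^{j}r_{-N+1}^{k}\ (0\le j\le p-1,\ k\in J_2),$$ and enumerate them as $E_1,\dots,E_q$. Then there are functions $\psi^{(1)},\dots,\psi^{(q)}\in L_2(G)$ with $\widehat{\psi^{(i)}}(\chi)=m_i(\chi)\,\hat\varphi(\chi\mathcal A^{-1})$, where $m_i=\mathbf 1_{E_i}$, and they generate a tight wavelet frame: for all $f\in L_2(G)$, $$\|f\|_2^2=\sum_{i=1}^q\sum_{n\in\mathbb Z}\sum_{h\in H_0}|\langle f,\psi^{(i)}_{n,h}\rangle|^2,\qquad \psi^{(i)}_{n,h}(x)=p^{n/2}\psi^{(i)}(\mathcal A^n x-h).$$ -/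

import Mathlib

open MeasureTheory Filter Topology
open scoped ComplexConjugate

/-! ### The Vilenkin group and its dual -/

/-- The sequences `(x_n)`, `n ∈ ℤ`, over `{0, …, p-1}` with finitely many nonzero terms of negative
index, as a subgroup of all sequences under coordinatewise addition modulo `p`. -/
def vilenkinSubgroup (p : ℕ) : AddSubgroup (ℤ → ZMod p) where
  carrier := {x | ∃ m : ℤ, ∀ n < m, x n = 0}
  zero_mem' := ⟨0, fun _ _ => rfl⟩
  add_mem' := by
    rintro x y ⟨m, hm⟩ ⟨k, hk⟩
    refine ⟨min m k, fun n hn => ?_⟩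
    simp [hm n (lt_of_lt_of_le hn (min_le_left _ _)), hk n (lt_of_lt_of_le hn (min_le_right _ _))]
  neg_mem' := by
    rintro x ⟨m, hm⟩
    exact ⟨m, fun n hn => by simp [hm n hn]⟩

/-- The Vilenkin group `G`. It is a type of its own, so that it does not inherit the product
topology. -/
def VilenkinGroup (p : ℕ) : Type := vilenkinSubgroup p

namespace VilenkinGroup

instance (p : ℕ) : AddCommGroup (VilenkinGroup p) :=
  inferInstanceAs (AddCommGroup (vilenkinSubgroup p))

/-- The coordinate `x_n`. -/
def coord {p : ℕ} (x : VilenkinGroup p) (n : ℤ) : ZMod p := x.1 n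

/-- The subgroup `G_n` of the `x` with `x_k = 0` for all `k < n`. -/
def level (p : ℕ) (n : ℤ) : AddSubgroup (VilenkinGroup p) where
  carrier := {x | ∀ k < n, x.coord k = 0}
  zero_mem' := fun _ _ => rfl
  add_mem' := by
    intro x y hx hy k hk
    change x.coord k + y.coord k = 0
    rw [hx k hk, hy k hk, add_zero]
  neg_mem' := by
    intro x hx k hk
    change -x.coord k = 0
    rw [hx k hk, neg_zero]

/-- The topology of `G`: its base is formed by the cosets of the subgroups `G_n`. -/
instance (p : ℕ) : TopologicalSpace (VilenkinGroup p) :=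
  TopologicalSpace.generateFrom {U | ∃ (n : ℤ) (a : VilenkinGroup p), U = {x | x - a ∈ level p n}}

instance (p : ℕ) : MeasurableSpace (VilenkinGroup p) := borel _

instance (p : ℕ) : BorelSpace (VilenkinGroup p) := ⟨rfl⟩

/-- The power `𝒜^n`, `n ∈ ℤ`, of the dilation `𝒜`, where `(𝒜 x)_k = x_{k+1}`. -/
def dilation (p : ℕ) (n : ℤ) : VilenkinGroup p ≃+ VilenkinGroup p where
  toFun x := ⟨fun k => x.coord (k + n), by
    obtain ⟨m, hm⟩ := x.2
    exact ⟨m - n, fun k hk => hm (k + n) (by omega)⟩⟩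
  invFun x := ⟨fun k => x.coord (k - n), by
    obtain ⟨m, hm⟩ := x.2
    exact ⟨m + n, fun k hk => hm (k - n) (by omega)⟩⟩
  left_inv x := Subtype.ext (funext fun k => by simp [coord])
  right_inv x := Subtype.ext (funext fun k => by simp [coord])
  map_add' _ _ := rfl

theorem continuous_dilation (p : ℕ) (n : ℤ) : Continuous (dilation p n) := by
  refine continuous_generateFrom_iff.2 ?_
  rintro U ⟨m, a, rfl⟩
  refine TopologicalSpace.isOpen_generateFrom_of_mem ⟨m + n, (dilation p n).symm a, ?_⟩
  ext x
  have h : dilation p n x - a = dilation p n (x - (dilation p n).symm a) := by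
    rw [map_sub, AddEquiv.apply_symm_apply]
  change dilation p n x - a ∈ level p m ↔ x - (dilation p n).symm a ∈ level p (m + n)
  rw [h]
  generalize x - (dilation p n).symm a = y
  constructor
  · intro hy k hk
    have := hy (k - n) (by omega)
    change y.coord (k - n + n) = 0 at this
    rwa [sub_add_cancel] at this
  · intro hy k hk
    exact hy (k + n) (by omega)

/-- The set `H_0` of the `h ∈ G` whose coordinates of index `≥ 0` vanish. -/
def shifts (p : ℕ) : Set (VilenkinGroup p) := {h | ∀ n : ℤ, 0 ≤ n → h.coord n = 0}

/-- The continuous characters `G → 𝕋`, as a subgroup of all homomorphisms `G → 𝕋`. -/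
def dualSubgroup (p : ℕ) : Subgroup (AddChar (VilenkinGroup p) Circle) where
  carrier := {χ | Continuous χ}
  one_mem' := by
    change Continuous fun _ => _
    exact continuous_const
  mul_mem' := by
    intro χ η hχ hη
    exact (Continuous.mul hχ hη : Continuous fun x => χ x * η x)
  inv_mem' := by
    intro χ hχ
    have h : (⇑χ⁻¹ : VilenkinGroup p → Circle) = fun x => (χ x)⁻¹ :=
      funext fun x => AddChar.inv_apply' χ x
    change Continuous (⇑χ⁻¹)
    rw [h]
    exact Continuous.inv hχ

/-- The group `X` of the characters of `G`. -/
def Dual (p : ℕ) : Type := dualSubgroup p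

namespace Dual

noncomputable instance (p : ℕ) : CommGroup (Dual p) := inferInstanceAs (CommGroup (dualSubgroup p))

/-- The value `(χ, x)` as a complex number. -/
noncomputable def val {p : ℕ} (χ : Dual p) (x : VilenkinGroup p) : ℂ := (χ.1 x : Circle)

/-- The annihilator `G_n^⊥`. -/
noncomputable def annihilator (p : ℕ) (n : ℤ) : Subgroup (Dual p) where
  carrier := {χ | ∀ x ∈ VilenkinGroup.level p n, χ.1 x = 1}
  one_mem' := fun _ _ => rfl
  mul_mem' := by
    intro χ η hχ hη x hx
    change χ.1 x * η.1 x = 1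
    rw [hχ x hx, hη x hx, one_mul]
  inv_mem' := by
    intro χ hχ x hx
    exact hχ (-x) (neg_mem hx)

/-- The topology of `X`: its base is formed by the cosets of the annihilators `G_n^⊥`. -/
instance (p : ℕ) : TopologicalSpace (Dual p) :=
  TopologicalSpace.generateFrom {U | ∃ (n : ℤ) (η : Dual p), U = {χ | χ * η⁻¹ ∈ annihilator p n}}

instance (p : ℕ) : MeasurableSpace (Dual p) := borel _

instance (p : ℕ) : BorelSpace (Dual p) := ⟨rfl⟩

/-- The character `χ𝒜^n`, that is `x ↦ (χ, 𝒜^n x)`. -/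
noncomputable def dilate {p : ℕ} (n : ℤ) (χ : Dual p) : Dual p :=
  ⟨χ.1.compAddMonoidHom (VilenkinGroup.dilation p n).toAddMonoidHom,
    (Continuous.comp (show Continuous χ.1 from χ.2) (VilenkinGroup.continuous_dilation p n) :
      Continuous (χ.1 ∘ VilenkinGroup.dilation p n))⟩

end Dual

/-- `(r_n)` is a Rademacher system: `r_n ∈ G_{n+1}^⊥ ∖ G_n^⊥` and `r_n 𝒜 = r_{n+1}`. -/
structure IsRademacher {p : ℕ} (r : ℤ → Dual p) : Prop where
  mem : ∀ n, r n ∈ Dual.annihilator p (n + 1)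
  notMem : ∀ n, r n ∉ Dual.annihilator p n
  dilate : ∀ n, Dual.dilate 1 (r n) = r (n + 1)

/-- `F` is the Fourier transform of `f ∈ L₂(G)`: the functions
`χ ↦ ∫_{G_{-n}} f(x) conj (χ, x) dμ(x)` converge to `F` in `L₂(X)` as `n → ∞`. -/
def IsFourierTransform {p : ℕ} (μ : Measure (VilenkinGroup p)) (ν : Measure (Dual p))
    (f : VilenkinGroup p → ℂ) (F : Dual p → ℂ) : Prop :=
  MemLp F 2 ν ∧
    Tendsto (fun n : ℕ =>
      eLpNorm (fun χ => (∫ x in (level p (-(n : ℤ)) : Set (VilenkinGroup p)),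
        f x * conj (χ.val x) ∂μ) - F χ) 2 ν) atTop (𝓝 0)

/-- `ψ_{n,h}(x) = p^{n/2} ψ(𝒜^n x - h)`. -/
noncomputable def wavelet {p : ℕ} (ψ : VilenkinGroup p → ℂ) (n : ℤ) (h : VilenkinGroup p)
    (x : VilenkinGroup p) : ℂ :=
  (((p : ℝ) ^ ((n : ℝ) / 2) : ℝ) : ℂ) * ψ (dilation p n x - h)

/-- The functions `ψ_i ∈ L₂(G)` generate a tight wavelet frame: for all `f ∈ L₂(G)`,
`‖f‖² = ∑ |⟨f, (ψ_i)_{n,h}⟩|²`, the sum being over all indices `i`, `n ∈ ℤ`, `h ∈ H_0`. -/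
def GeneratesTightWaveletFrame {p : ℕ} (μ : Measure (VilenkinGroup p)) {ι : Type*}
    (ψ : ι → VilenkinGroup p → ℂ) : Prop :=
  (∀ i, MemLp (ψ i) 2 μ) ∧
    ∀ f : VilenkinGroup p → ℂ, MemLp f 2 μ →
      HasSum (fun k : ι × ℤ × shifts p =>
        ‖∫ x, f x * conj (wavelet (ψ k.1) k.2.1 (k.2.2 : VilenkinGroup p) x) ∂μ‖ ^ 2)
        (∫ x, ‖f x‖ ^ 2 ∂μ)

end VilenkinGroup

/-! ### Trees, masks and refinable functions -/

universe u

/-- A rooted tree whose vertices carry labels in `{0, …, p-1}`. Every vertex except the root has a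
parent, one level below. (The value `parent root` is never used.) -/
structure LabelledTree (p : ℕ) where
  /-- the vertices -/
  V : Type u
  /-- the root -/
  root : V
  /-- the parent of a vertex other than the root -/
  parent : V → V
  /-- the level of a vertex, counted from zero -/
  level : V → ℕ
  /-- the label of a vertex -/
  label : V → ZMod p
  level_eq_zero_iff : ∀ v, level v = 0 ↔ v = root
  level_parent : ∀ v, v ≠ root → level (parent v) + 1 = level v

namespace LabelledTree

variable {p : ℕ}

/-- `T` is `N`-valid: the root and the vertices of level `1, …, N-1` are labelled zero, and for each
word of `N` labels there is exactly one path of `N` vertices (of length `N-1`) in `T` that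
carries it. Such a path is given by its end `v` farthest from the root, and runs through
`v`, `parent v`, …, `parent^[N-1] v`; it exists when `v` has level at least `N-1`. -/
def IsValid (T : LabelledTree.{u} p) (N : ℕ) : Prop :=
  (∀ v, v = T.root ∨ T.level v < N → T.label v = 0) ∧
    ∀ α : Fin N → ZMod p,
      ∃! v : T.V, N ≤ T.level v + 1 ∧ ∀ i : Fin N, T.label (T.parent^[i] v) = α i

/-- The edges of `T`, directed towards the root. -/
def Edge (T : LabelledTree.{u} p) (v w : T.V) : Prop := v ≠ T.root ∧ w = T.parent v

/-- The edges of the directed graph `Γ`: the edges of `T`, and an edge from each `v` of level more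
than `N-1` to each `w` of a lower level which is the starting point of a path towards the root
of `N-1` vertices with the labels of `parent v`, `parent^[2] v`, …, `parent^[N-1] v`. -/
def GraphEdge (T : LabelledTree.{u} p) (N : ℕ) (v w : T.V) : Prop :=
  T.Edge v w ∨
    (N ≤ T.level v ∧ T.level w < T.level v ∧ N ≤ T.level w + 2 ∧
      ∀ i : ℕ, i + 1 < N → T.label (T.parent^[i] w) = T.label (T.parent^[i + 1] v))

/-- The word `α = (α_{-N}, …, α_0)` (with `α_{-N+i}` written `α i`) is carried by a directed path
of `Γ`. -/
def InGraph (T : LabelledTree.{u} p) (N : ℕ) (α : Fin (N + 1) → ZMod p) : Prop :=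
  ∃ c : Fin (N + 1) → T.V,
    (∀ i : Fin N, T.GraphEdge N (c i.castSucc) (c i.succ)) ∧ ∀ i, T.label (c i) = α i

open Classical in
/-- The array `λ_{α_{-N}, …, α_0}`. -/
noncomputable def lam (T : LabelledTree.{u} p) (N : ℕ) (α : Fin (N + 1) → ZMod p) : ℂ :=
  if α = 0 ∨ T.InGraph N α then 1 else 0

open Classical in
/-- The mask `m_0`: it is equal to `λ_{α_{-N}, …, α_0}` on the coset
`G_{-N}^⊥ r_{-N}^{α_{-N}} ⋯ r_0^{α_0}` and on its translates by the products
`r_1^{β_1} ⋯ r_l^{β_l}`. For a given `α` these sets are disjoint from those for any other `α`, and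
all of them together cover `X`, so that exactly one summand has an indicator different from zero. -/
noncomputable def mask (T : LabelledTree.{u} p) (N : ℕ) [NeZero p]
    (r : ℤ → VilenkinGroup.Dual p) (χ : VilenkinGroup.Dual p) : ℂ :=
  ∑ α : Fin (N + 1) → ZMod p,
    if ∃ (l : ℕ) (β : ℕ → ZMod p),
        χ * ((∏ i : Fin (N + 1), r (-(N : ℤ) + (i : ℕ)) ^ (α i).val) *
          ∏ j ∈ Finset.Icc 1 l, r (j : ℤ) ^ (β j).val)⁻¹
          ∈ VilenkinGroup.Dual.annihilator p (-(N : ℤ))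
    then T.lam N α else 0

/-- The Fourier transform of the refinable function: `φ̂(χ) = ∏_{k ≥ 0} m_0(χ𝒜^{-k})`. (For every
`χ` all but finitely many factors are `1`.) -/
noncomputable def phiHat (T : LabelledTree.{u} p) (N : ℕ) [NeZero p]
    (r : ℤ → VilenkinGroup.Dual p) (χ : VilenkinGroup.Dual p) : ℂ :=
  ∏' k : ℕ, T.mask N r (VilenkinGroup.Dual.dilate (-(k : ℤ)) χ)

end LabelledTree

/-! ### The cosets that carry the wavelet masks -/

namespace VilenkinGroup

/-- The cosets `G_{-N+1}^⊥ r_{-N+1}^k` with `k ∈ J₁`, and `G_{-N}^⊥ r_{-N}^j r_{-N+1}^k` with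
`0 ≤ j ≤ p-1` and `k ∈ J₂`. -/
def waveletCoset {p : ℕ} (N : ℕ) (r : ℤ → Dual p) (J₁ J₂ : Finset (ZMod p)) :
    J₁ ⊕ ZMod p × J₂ → Set (Dual p)
  | Sum.inl k =>
      {χ | χ * (r (-(N : ℤ) + 1) ^ (k : ZMod p).val)⁻¹ ∈ Dual.annihilator p (-(N : ℤ) + 1)}
  | Sum.inr (j, k) =>
      {χ | χ * (r (-(N : ℤ)) ^ j.val * r (-(N : ℤ) + 1) ^ (k : ZMod p).val)⁻¹ ∈
        Dual.annihilator p (-(N : ℤ))}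

end VilenkinGroup

/-! ### The topology of the Vilenkin group -/

namespace VilenkinGroup

variable {p : ℕ}

/-! Modulo `G_n^⊥` every character has a unique digit expansion in the `r_j`, `j ≥ n`
(`exists_hasDigits`, `hasDigits_unique`). The factor `m_0(χ𝒜^{-k})` reads the window of digits
`-N+k, …, k`, so `φ̂` is `1` or `0` according to whether or not every window is zero or carried by
`Γ` (`phiHat_eq`). Consecutive windows share `N` labels, and by validity these determine a vertex.
Hence the vertices where nonzero windows start form a walk in `Γ`, along which the level drops
strictly. The height of the tree is bounded because there are finitely many words, so the digits
vanish from a fixed place on (`eq_zero_of_windows`). Thus `φ̂` is a finite combination of indicators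
of cosets of `G_{-N}^⊥`, each of them the transform of a function `p^n 1_{G_n} η`.

For the frame, the labels of level `N` give `φ̂ = 1` on `G_{-N+1}^⊥` (`phiHat_eq_one`), which
contains `χ𝒜^{-1}` for every `χ ∈ E_i`. So `ψ̂_i` is just the indicator of `E_i`, and the tree plays
no further role. Translates of `ψ_i` supported on the same ball differ by a phase, and their number
cancels the normalisation, so the coefficients of a fixed dilation sum to an `energy` of `f` over
balls of one radius. For `k ∈ J₁` this is the energy for `r_s^k`; for `k ∈ J₂` the sum over `j`
merges `p` energies of radius `s` into one of radius `s+1`, by Parseval on `ℤ/p` (`sum_energy`).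
Either way `k` contributes exactly what the Haar wavelets built from `r_s^k` do, and those form an
orthonormal basis (`hasSum_haarWavelet`). -/

theorem ext_coord {x y : VilenkinGroup p} (h : ∀ n, x.coord n = y.coord n) : x = y :=
  Subtype.ext (funext h)

@[simp] theorem coord_add (x y : VilenkinGroup p) (n : ℤ) :
    (x + y).coord n = x.coord n + y.coord n := rfl

@[simp] theorem coord_zero (n : ℤ) : (0 : VilenkinGroup p).coord n = 0 := rfl

@[simp] theorem coord_neg (x : VilenkinGroup p) (n : ℤ) : (-x).coord n = -x.coord n := rfl

@[simp] theorem coord_sub (x y : VilenkinGroup p) (n : ℤ) :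
    (x - y).coord n = x.coord n - y.coord n := by
  rw [sub_eq_add_neg, coord_add, coord_neg, sub_eq_add_neg]

@[simp] theorem coord_nsmul (m : ℕ) (x : VilenkinGroup p) (n : ℤ) :
    (m • x).coord n = m • x.coord n := by
  induction m with
  | zero => simp
  | succ m ih => rw [succ_nsmul, coord_add, ih, succ_nsmul]

@[simp] theorem coord_dilation (x : VilenkinGroup p) (m n : ℤ) :
    (dilation p m x).coord n = x.coord (n + m) := rfl

theorem mem_level {n : ℤ} {x : VilenkinGroup p} : x ∈ level p n ↔ ∀ k < n, x.coord k = 0 :=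
  Iff.rfl

theorem dilation_zero (x : VilenkinGroup p) : dilation p 0 x = x :=
  ext_coord fun n => by simp

theorem dilation_dilation (m n : ℤ) (x : VilenkinGroup p) :
    dilation p m (dilation p n x) = dilation p (m + n) x :=
  ext_coord fun k => by simp [add_assoc]

theorem dilation_mem_level {m n : ℤ} {x : VilenkinGroup p} :
    dilation p m x ∈ level p n ↔ x ∈ level p (n + m) := by
  simp only [mem_level, coord_dilation]
  constructor
  · intro h k hk
    simpa using h (k - m) (by omega)
  · intro h k hk
    exact h _ (by omega)

theorem level_antitone : Antitone (level p) :=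
  fun _ _ hmn _ hx k hk => hx k (lt_of_lt_of_le hk hmn)

/-- This exponent is why all character values are `p`-th roots of unity. -/
theorem natCast_nsmul_eq_zero (x : VilenkinGroup p) : p • x = 0 :=
  ext_coord fun n => by simp

/-- The element with the coordinate `a` at `n` and all other coordinates zero. -/
def single (n : ℤ) (a : ZMod p) : VilenkinGroup p :=
  ⟨fun k => if k = n then a else 0, n, fun k hk => by simp [hk.ne]⟩

theorem coord_single (n : ℤ) (a : ZMod p) (k : ℤ) :
    (single n a).coord k = if k = n then a else 0 := rfl

theorem single_mem_level (n : ℤ) (a : ZMod p) : single n a ∈ level p n :=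
  fun k hk => by simp [coord_single, hk.ne]

theorem single_eq_nsmul [NeZero p] (n : ℤ) (a : ZMod p) : single n a = a.val • single n 1 :=
  ext_coord fun k => by
    rw [coord_nsmul, coord_single, coord_single]
    split_ifs <;> simp

theorem sub_single_mem_level {n : ℤ} {x : VilenkinGroup p} (hx : x ∈ level p n) :
    x - single n (x.coord n) ∈ level p (n + 1) := by
  intro k hk
  rw [coord_sub, coord_single]
  split_ifs with h
  · rw [h, sub_self]
  · rw [hx k (by omega), sub_zero]

theorem isOpen_setOf_sub_mem_level (n : ℤ) (a : VilenkinGroup p) :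
    IsOpen {x | x - a ∈ level p n} :=
  TopologicalSpace.isOpen_generateFrom_of_mem ⟨n, a, rfl⟩

/-- The `G_n` are nested, so the generating cosets already form a base. -/
theorem isOpen_iff_level {U : Set (VilenkinGroup p)} :
    IsOpen U ↔ ∀ x ∈ U, ∃ n, ∀ y, y - x ∈ level p n → y ∈ U := by
  constructor
  · intro hU
    induction hU with
    | basic s hs =>
      obtain ⟨n, a, rfl⟩ := hs
      intro x hx
      refine ⟨n, fun y hy => ?_⟩
      have := add_mem hy hx
      rwa [sub_add_sub_cancel] at this
    | univ => exact fun x _ => ⟨0, fun y _ => trivial⟩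
    | inter s t _ _ hs ht =>
      rintro x ⟨hxs, hxt⟩
      obtain ⟨m, hm⟩ := hs x hxs
      obtain ⟨n, hn⟩ := ht x hxt
      exact ⟨max m n, fun y hy => ⟨hm y (level_antitone (le_max_left _ _) hy),
        hn y (level_antitone (le_max_right _ _) hy)⟩⟩
    | sUnion S _ hS =>
      rintro x ⟨s, hs, hxs⟩
      obtain ⟨n, hn⟩ := hS s hs x hxs
      exact ⟨n, fun y hy => ⟨s, hs, hn y hy⟩⟩
  · intro h
    refine isOpen_iff_forall_mem_open.2 fun x hx => ?_
    obtain ⟨n, hn⟩ := h x hx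
    refine ⟨{y | y - x ∈ level p n}, hn, isOpen_setOf_sub_mem_level n x, ?_⟩
    change x - x ∈ level p n
    rw [sub_self]
    exact zero_mem _

theorem continuous_const_add (a : VilenkinGroup p) : Continuous fun x => a + x := by
  refine continuous_def.2 fun U hU => isOpen_iff_level.2 fun x hx => ?_
  obtain ⟨n, hn⟩ := isOpen_iff_level.1 hU _ hx
  exact ⟨n, fun y hy => hn _ (by rwa [add_sub_add_left_eq_sub])⟩

/-- Measurable translations are all that the invariance of `μ` requires below. -/
instance : MeasurableAdd (VilenkinGroup p) where
  measurable_const_add a := (continuous_const_add a).measurable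
  measurable_add_const a := by
    simpa only [add_comm] using (continuous_const_add a).measurable

theorem exists_mem_level (x : VilenkinGroup p) : ∃ n, x ∈ level p n := x.2

/-- The ball `𝒜^{-s} h + G_s`. -/
def ball (s : ℤ) (h : VilenkinGroup p) : Set (VilenkinGroup p) :=
  {x | dilation p s x - h ∈ level p 0}

theorem mem_ball_iff {s : ℤ} {h x : VilenkinGroup p} :
    x ∈ ball s h ↔ ∀ k < s, x.coord k = h.coord (k - s) := by
  change (∀ k < 0, _) ↔ _
  simp only [coord_sub, coord_dilation, sub_eq_zero]
  constructor
  · intro H k hk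
    simpa using H (k - s) (by omega)
  · intro H k hk
    simpa using H (k + s) (by omega)

theorem mem_ball_iff_sub_mem {s : ℤ} {h x y : VilenkinGroup p} (hy : y ∈ ball s h) :
    x ∈ ball s h ↔ x - y ∈ level p s := by
  simp only [mem_ball_iff, mem_level, coord_sub, sub_eq_zero] at *
  exact forall₂_congr fun k hk => by rw [hy k hk]

theorem dilation_neg_mem_ball (s : ℤ) (h : VilenkinGroup p) : dilation p (-s) h ∈ ball s h := by
  simp [mem_ball_iff, sub_eq_add_neg]

theorem ball_eq (s : ℤ) (h : VilenkinGroup p) :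
    ball s h = {x | x - dilation p (-s) h ∈ level p s} :=
  Set.ext fun _ => mem_ball_iff_sub_mem (dilation_neg_mem_ball s h)

theorem isOpen_ball (s : ℤ) (h : VilenkinGroup p) : IsOpen (ball s h) :=
  ball_eq s h ▸ isOpen_setOf_sub_mem_level _ _

theorem measurableSet_ball (s : ℤ) (h : VilenkinGroup p) : MeasurableSet (ball s h) :=
  (isOpen_ball s h).measurableSet

/-- The sequence `x` with all coordinates of index at least `n` replaced by zero. -/
def truncate (n : ℤ) (x : VilenkinGroup p) : VilenkinGroup p :=
  ⟨fun k => if k < n then x.coord k else 0, by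
    obtain ⟨m, hm⟩ := x.2
    refine ⟨m, fun k hk => ?_⟩
    have : x.coord k = 0 := hm k hk
    simp [this]⟩

theorem coord_truncate (n : ℤ) (x : VilenkinGroup p) (k : ℤ) :
    (truncate n x).coord k = if k < n then x.coord k else 0 := rfl

theorem truncate_mem_shifts (x : VilenkinGroup p) : truncate 0 x ∈ shifts p :=
  fun n hn => by simp [coord_truncate, hn]

/-- The element of `H_0` that indexes the ball of `x`. -/
def center (s : ℤ) (x : VilenkinGroup p) : shifts p :=
  ⟨truncate 0 (dilation p s x), truncate_mem_shifts _⟩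

/-- For fixed `s` the balls indexed by `H_0` partition `G`; `center s` picks the part. -/
theorem mem_ball_shifts_iff {s : ℤ} {h : shifts p} {x : VilenkinGroup p} :
    x ∈ ball s (h : VilenkinGroup p) ↔ center s x = h := by
  rw [mem_ball_iff, Subtype.ext_iff]
  constructor
  · intro H
    refine ext_coord fun k => ?_
    simp only [center, coord_truncate, coord_dilation]
    split_ifs with hk
    · rw [H (k + s) (by omega), add_sub_cancel_right]
    · exact (h.2 k (by omega)).symm
  · intro H k hk
    rw [← H]
    simp [center, coord_truncate, hk]

/-- Elements of `H_0` have finite support. -/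
instance [NeZero p] : Countable (shifts p) := by
  have hfin : ∀ h : shifts p, (Function.support (h : VilenkinGroup p).coord).Finite := by
    intro h
    obtain ⟨m, hm⟩ := exists_mem_level (h : VilenkinGroup p)
    refine (Set.finite_Ico m 0).subset fun k hk => ?_
    by_contra hk'
    apply hk
    rcases lt_or_ge k m with h1 | h1
    · exact hm k h1
    · exact h.2 k (by simpa [h1] using hk')
  refine Function.Injective.countable
    (f := fun h : shifts p => Finsupp.ofSupportFinite (h : VilenkinGroup p).coord (hfin h)) ?_
  intro h h' heq
  exact Subtype.ext (ext_coord fun k => DFunLike.congr_fun heq k)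

theorem generateFrom_balls :
    (inferInstance : TopologicalSpace (VilenkinGroup p)) =
      TopologicalSpace.generateFrom (Set.range fun k : ℤ × shifts p => ball k.1 k.2.1) := by
  change TopologicalSpace.generateFrom _ = _
  congr 1
  ext U
  constructor
  · rintro ⟨n, a, rfl⟩
    refine ⟨(n, center n a), Set.ext fun x => ?_⟩
    exact mem_ball_iff_sub_mem (mem_ball_shifts_iff.2 rfl)
  · rintro ⟨k, rfl⟩
    exact ⟨_, _, ball_eq _ _⟩

instance [NeZero p] : SecondCountableTopology (VilenkinGroup p) :=
  ⟨_, Set.countable_range _, generateFrom_balls⟩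

theorem measurableSpace_eq_generateFrom_balls [NeZero p] :
    (inferInstance : MeasurableSpace (VilenkinGroup p)) =
      MeasurableSpace.generateFrom (Set.range fun k : ℤ × shifts p => ball k.1 k.2.1) := by
  rw [← borel_eq_generateFrom_of_subbasis generateFrom_balls]
  exact BorelSpace.measurable_eq

theorem ball_subset_ball {s t : ℤ} (hst : s ≤ t) {h h' x : VilenkinGroup p} (hx : x ∈ ball s h)
    (hx' : x ∈ ball t h') : ball t h' ⊆ ball s h := fun y hy => by
  rw [mem_ball_iff_sub_mem hx]
  exact level_antitone hst ((mem_ball_iff_sub_mem hx').1 hy)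

/-- The geometry is ultrametric: two balls that meet are nested. -/
theorem isPiSystem_balls :
    IsPiSystem (Set.range fun k : ℤ × shifts p => ball k.1 k.2.1) := by
  rintro _ ⟨⟨s, h⟩, rfl⟩ _ ⟨⟨t, h'⟩, rfl⟩ ⟨x, hx, hx'⟩
  rcases le_total s t with hst | hst
  · exact ⟨(t, h'), (Set.inter_eq_right.2 (ball_subset_ball hst hx hx')).symm⟩
  · exact ⟨(s, h), (Set.inter_eq_left.2 (ball_subset_ball hst hx' hx)).symm⟩

/-- Splitting off the last digit of an element of `H_0`. -/
def shiftsEquiv (p : ℕ) : ZMod p × shifts p ≃ shifts p where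
  -- The dilation moves the digits one place left and frees index `-1`; this is how a ball of radius
  -- `s` splits into `p` balls of radius `s+1`.
  toFun k := ⟨dilation p 1 k.2 + single (-1) k.1, fun n hn => by
    rw [coord_add, coord_dilation, coord_single, k.2.2 _ (by omega), if_neg (by omega), add_zero]⟩
  invFun h := ((h : VilenkinGroup p).coord (-1), center (-1) h)
  left_inv k := by
    refine Prod.ext ?_ (Subtype.ext (ext_coord fun n => ?_))
    · simp [coord_single, k.2.2 0 le_rfl]
    · simp only [center, coord_truncate, coord_dilation, coord_add, coord_single]
      split_ifs with h1 h2
      · omega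
      · simp
      · exact (k.2.2 n (by omega)).symm
  right_inv h := by
    refine Subtype.ext (ext_coord fun n => ?_)
    simp only [center, coord_truncate, coord_dilation, coord_add, coord_single]
    split_ifs with h1 h2 h2
    · omega
    · simp
    · simp [h2]
    · simpa using (h.2 n (by omega)).symm

theorem center_shiftsEquiv (k : ZMod p × shifts p) :
    center (-1) (shiftsEquiv p k : VilenkinGroup p) = k.2 :=
  congrArg Prod.snd ((shiftsEquiv p).left_inv k)

theorem center_center (s : ℤ) (x : VilenkinGroup p) {t : ℤ} (ht : t ≤ 0) :
    center t (center s x : VilenkinGroup p) = center (t + s) x := by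
  refine Subtype.ext (ext_coord fun n => ?_)
  simp only [center, coord_truncate, coord_dilation]
  split_ifs with h1 h2
  · rw [add_assoc]
  · omega
  · rfl

end VilenkinGroup

/-! ### Characters and Haar measure -/

namespace VilenkinGroup

variable {p : ℕ}

namespace Dual

theorem val_add (χ : Dual p) (x y : VilenkinGroup p) : χ.val (x + y) = χ.val x * χ.val y := by
  simp [val, AddChar.map_add_eq_mul]

@[simp] theorem val_zero (χ : Dual p) : χ.val 0 = 1 := by
  simp [val]

theorem val_mul (χ η : Dual p) (x : VilenkinGroup p) : (χ * η).val x = χ.val x * η.val x := rfl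

@[simp] theorem val_one (x : VilenkinGroup p) : (1 : Dual p).val x = 1 := rfl

@[simp] theorem norm_val (χ : Dual p) (x : VilenkinGroup p) : ‖χ.val x‖ = 1 :=
  Circle.norm_coe _

theorem val_ne_zero (χ : Dual p) (x : VilenkinGroup p) : χ.val x ≠ 0 := by
  simp [val]

theorem val_mul_conj (χ : Dual p) (x : VilenkinGroup p) : χ.val x * conj (χ.val x) = 1 := by
  rw [Complex.mul_conj']
  simp

theorem val_inv (χ : Dual p) (x : VilenkinGroup p) : (χ⁻¹).val x = conj (χ.val x) := by
  have h : (χ * χ⁻¹).val x = 1 := by rw [mul_inv_cancel, val_one]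
  rw [val_mul, ← χ.val_mul_conj x] at h
  exact mul_left_cancel₀ (χ.val_ne_zero x) h

theorem val_pow (χ : Dual p) (m : ℕ) (x : VilenkinGroup p) : (χ ^ m).val x = χ.val x ^ m := by
  induction m with
  | zero => simp
  | succ m ih => rw [pow_succ, val_mul, ih, pow_succ]

theorem val_nsmul (χ : Dual p) (m : ℕ) (x : VilenkinGroup p) : χ.val (m • x) = χ.val x ^ m := by
  induction m with
  | zero => simp
  | succ m ih => rw [succ_nsmul, val_add, ih, pow_succ]

theorem val_neg (χ : Dual p) (x : VilenkinGroup p) : χ.val (-x) = conj (χ.val x) := by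
  have h : χ.val (x + -x) = 1 := by rw [add_neg_cancel, val_zero]
  rw [val_add, ← χ.val_mul_conj x] at h
  exact mul_left_cancel₀ (χ.val_ne_zero x) h

theorem val_sub (χ : Dual p) (x y : VilenkinGroup p) :
    χ.val (x - y) = χ.val x * conj (χ.val y) := by
  rw [sub_eq_add_neg, val_add, val_neg]

theorem val_pow_card (χ : Dual p) (x : VilenkinGroup p) : χ.val x ^ p = 1 := by
  rw [← val_nsmul, natCast_nsmul_eq_zero, val_zero]

@[simp] theorem val_dilate (n : ℤ) (χ : Dual p) (x : VilenkinGroup p) :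
    (dilate n χ).val x = χ.val (dilation p n x) := rfl

theorem ext_val {χ η : Dual p} (h : ∀ x, χ.val x = η.val x) : χ = η :=
  Subtype.ext (DFunLike.ext _ _ fun x => Circle.ext (h x))

theorem continuous_val (χ : Dual p) : Continuous χ.val :=
  continuous_subtype_val.comp (show Continuous χ.1 from χ.2)

theorem mem_annihilator {n : ℤ} {χ : Dual p} :
    χ ∈ annihilator p n ↔ ∀ x ∈ level p n, χ.val x = 1 :=
  forall₂_congr fun x _ => by rw [val, Circle.coe_eq_one]

theorem annihilator_mono : Monotone (annihilator p) :=
  fun _ _ hmn _ hχ x hx => hχ x (level_antitone hmn hx)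

theorem dilate_mul (n : ℤ) (χ η : Dual p) : dilate n (χ * η) = dilate n χ * dilate n η := rfl

theorem dilate_one (n : ℤ) : dilate n (1 : Dual p) = 1 := rfl

/-- The dilation of characters as a homomorphism. -/
noncomputable def dilateHom (p : ℕ) (n : ℤ) : Dual p →* Dual p where
  toFun := dilate n
  map_one' := dilate_one n
  map_mul' := dilate_mul n

theorem dilateHom_apply (n : ℤ) (χ : Dual p) : dilateHom p n χ = dilate n χ := rfl

theorem dilate_dilate (m n : ℤ) (χ : Dual p) : dilate m (dilate n χ) = dilate (m + n) χ :=
  ext_val fun x => by simp [dilation_dilation, add_comm]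

theorem dilate_zero (χ : Dual p) : dilate 0 χ = χ :=
  ext_val fun x => by simp [dilation_zero]

theorem dilate_mem_annihilator {m n : ℤ} {χ : Dual p} :
    dilate m χ ∈ annihilator p n ↔ χ ∈ annihilator p (n - m) := by
  simp only [mem_annihilator, val_dilate]
  constructor
  · intro h x hx
    have := h (dilation p (-m) x) (dilation_mem_level.2 (by simpa [sub_eq_add_neg] using hx))
    rwa [dilation_dilation, add_neg_cancel, dilation_zero] at this
  · intro h x hx
    exact h _ (dilation_mem_level.2 (by simpa using hx))

/-- A continuous character is trivial on some `G_n`. -/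
theorem exists_mem_annihilator [NeZero p] (χ : Dual p) : ∃ n, χ ∈ annihilator p n := by
  -- The values of `χ` are `p`-th roots of unity, so `1` is isolated among them and `χ = 1` on a
  -- neighbourhood of `0`.
  have hfin : {z : ℂ | z ^ p = 1 ∧ z ≠ 1}.Finite := by
    refine (Polynomial.nthRoots p (1 : ℂ)).toFinset.finite_toSet.subset fun z hz => ?_
    simpa [Polynomial.mem_nthRoots (NeZero.pos p)] using hz.1
  have hopen := hfin.isClosed.isOpen_compl.preimage χ.continuous_val
  obtain ⟨n, hn⟩ := isOpen_iff_level.1 hopen 0 (by simp)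
  refine ⟨n, mem_annihilator.2 fun x hx => ?_⟩
  by_contra h
  exact hn x (by simpa using hx) ⟨χ.val_pow_card x, h⟩

/-- A character in `G_{n+1}^⊥` is determined on `G_n` by its value at one element. -/
theorem val_eq_of_mem_annihilator [NeZero p] {n : ℤ} {χ : Dual p} (hχ : χ ∈ annihilator p (n + 1))
    {x : VilenkinGroup p} (hx : x ∈ level p n) :
    χ.val x = χ.val (single n 1) ^ (x.coord n).val := by
  have h := mem_annihilator.1 hχ _ (sub_single_mem_level hx)
  rw [← val_nsmul, ← single_eq_nsmul]
  have h2 := χ.val_add (x - single n (x.coord n)) (single n (x.coord n))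
  rwa [sub_add_cancel, h, one_mul] at h2

theorem mem_annihilator_iff_val_single [NeZero p] {n : ℤ} {χ : Dual p}
    (hχ : χ ∈ annihilator p (n + 1)) : χ ∈ annihilator p n ↔ χ.val (single n 1) = 1 :=
  ⟨fun h => mem_annihilator.1 h _ (single_mem_level _ _), fun h => mem_annihilator.2 fun x hx => by
    rw [val_eq_of_mem_annihilator hχ hx, h, one_pow]⟩

/-- Characters in `annihilator p s` are constant on the balls of radius `s`. -/
theorem val_eq_of_mem_ball {s : ℤ} {χ : Dual p} (hχ : χ ∈ annihilator p s) {h x y : VilenkinGroup p}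
    (hx : x ∈ ball s h) (hy : y ∈ ball s h) : χ.val x = χ.val y := by
  have := mem_annihilator.1 hχ _ ((mem_ball_iff_sub_mem hy).1 hx)
  have h2 := χ.val_add (x - y) y
  rwa [sub_add_cancel, this, one_mul] at h2

end Dual

theorem ball_zero_eq_level (s : ℤ) : ball s (0 : VilenkinGroup p) = level p s := by
  ext x
  rw [mem_ball_iff]
  rfl

/-! ### Haar measure of balls and integrals of characters over them -/

section Haar

variable (μ : Measure (VilenkinGroup p)) [μ.IsAddHaarMeasure]

theorem measure_setOf_sub_mem (n : ℤ) (a : VilenkinGroup p) :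
    μ {x | x - a ∈ level p n} = μ (level p n : Set (VilenkinGroup p)) := by
  rw [← measure_preimage_add μ (-a) (level p n : Set (VilenkinGroup p))]
  congr 1
  ext x
  change x - a ∈ level p n ↔ -a + x ∈ level p n
  rw [sub_eq_neg_add]

/-- The coordinate at `n` splits `G_n` into `p` cosets of `G_{n+1}`. -/
theorem measure_level_succ [NeZero p] (n : ℤ) :
    μ (level p n : Set (VilenkinGroup p)) = p * μ (level p (n + 1) : Set (VilenkinGroup p)) := by
  have h : (level p n : Set (VilenkinGroup p)) =
      ⋃ d : ZMod p, {x | x - single n d ∈ level p (n + 1)} := by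
    ext x
    simp only [Set.mem_iUnion, SetLike.mem_coe, Set.mem_ofPred_eq]
    constructor
    · exact fun hx => ⟨x.coord n, sub_single_mem_level hx⟩
    · rintro ⟨d, hd⟩
      have := add_mem (level_antitone (by omega : n ≤ n + 1) hd) (single_mem_level n d)
      rwa [sub_add_cancel] at this
  rw [h, measure_iUnion]
  · simp [measure_setOf_sub_mem, tsum_fintype, ZMod.card]
  · intro d d' hdd'
    refine Set.disjoint_left.2 fun x hx hx' => hdd' ?_
    have h1 := mem_level.1 hx n (by omega)
    have h2 := mem_level.1 hx' n (by omega)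
    simp only [coord_sub, coord_single, if_true, sub_eq_zero] at h1 h2
    rw [← h1, h2]
  · exact fun d => (isOpen_setOf_sub_mem_level _ _).measurableSet

theorem measure_level [NeZero p] (hμ : μ (level p 0 : Set (VilenkinGroup p)) = 1)
    (n : ℤ) :
    μ (level p n : Set (VilenkinGroup p)) = (p : ENNReal) ^ (-n) := by
  have hp0 : (p : ENNReal) ≠ 0 := by simp [NeZero.ne p]
  have hpt : (p : ENNReal) ≠ ⊤ := ENNReal.natCast_ne_top p
  induction n using Int.induction_on with
  | zero => simp [hμ]
  | succ n ih =>
    rw [measure_level_succ] at ih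
    rw [← ENNReal.mul_right_inj hp0 hpt, ih, neg_add, ENNReal.zpow_add hp0 hpt, mul_comm, mul_assoc,
      zpow_neg_one, ENNReal.inv_mul_cancel hp0 hpt, mul_one]
  | pred n ih =>
    rw [measure_level_succ, sub_add_cancel, ih, neg_sub, sub_neg_eq_add, ENNReal.zpow_add hp0 hpt,
      zpow_one, neg_neg]

theorem measure_ball [NeZero p] (hμ : μ (level p 0 : Set (VilenkinGroup p)) = 1)
    (s : ℤ) (h : VilenkinGroup p) :
    μ (ball s h) = (p : ENNReal) ^ (-s) := by
  rw [ball_eq, measure_setOf_sub_mem, measure_level μ hμ]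

theorem measure_ball_lt_top [NeZero p] (hμ : μ (level p 0 : Set (VilenkinGroup p)) = 1)
    (s : ℤ) (h : VilenkinGroup p) : μ (ball s h) < ⊤ := by
  rw [measure_ball μ hμ]
  exact ENNReal.zpow_lt_top (by simp [NeZero.ne p]) (ENNReal.natCast_ne_top p) _

theorem measureReal_ball [NeZero p] (hμ : μ (level p 0 : Set (VilenkinGroup p)) = 1)
    (s : ℤ) (h : VilenkinGroup p) :
    μ.real (ball s h) = (p : ℝ) ^ (-s) := by
  rw [Measure.real, measure_ball μ hμ]
  cases s using Int.negInduction <;> simp [ENNReal.zpow_neg]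

/-- Translation by some `g ∈ G_s` with `χ(g) ≠ 1` preserves the ball and multiplies the integral by
`χ(g)`. -/
theorem integral_ball_val_eq_zero {s : ℤ} {h : VilenkinGroup p} {χ : Dual p}
    (hχ : χ ∉ Dual.annihilator p s) : ∫ x in ball s h, χ.val x ∂μ = 0 := by
  rw [Dual.mem_annihilator] at hχ
  push Not at hχ
  obtain ⟨g, hg, hχg⟩ := hχ
  rw [← integral_indicator (measurableSet_ball s h)]
  set I := ∫ x, (ball s h).indicator χ.val x ∂μ with hI
  have h1 : ∀ x, (ball s h).indicator χ.val (g + x) = χ.val g * (ball s h).indicator χ.val x := by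
    intro x
    have : g + x ∈ ball s h ↔ x ∈ ball s h := by
      simp only [mem_ball_iff, coord_add]
      exact forall₂_congr fun k hk => by rw [hg k hk, zero_add]
    by_cases hx : x ∈ ball s h
    · rw [Set.indicator_of_mem hx, Set.indicator_of_mem (this.2 hx), Dual.val_add]
    · rw [Set.indicator_of_notMem hx, Set.indicator_of_notMem (mt this.1 hx), mul_zero]
  have h2 : I = χ.val g * I := by
    conv_lhs => rw [hI, ← integral_add_left_eq_self _ g]
    simp_rw [h1]
    rw [integral_const_mul]
  have h3 : (1 - χ.val g) * I = 0 := by rw [sub_mul, one_mul, ← h2, sub_self]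
  exact (mul_eq_zero.1 h3).resolve_left (sub_ne_zero.2 (Ne.symm hχg))

theorem integral_level_val [NeZero p] (hμ : μ (level p 0 : Set (VilenkinGroup p)) = 1)
    (s : ℤ) (χ : Dual p) [Decidable (χ ∈ Dual.annihilator p s)] :
    ∫ x in (level p s : Set (VilenkinGroup p)), χ.val x ∂μ =
      if χ ∈ Dual.annihilator p s then (p : ℂ) ^ (-s) else 0 := by
  rw [← ball_zero_eq_level]
  split_ifs with h
  · rw [setIntegral_congr_fun (g := fun _ => (1 : ℂ)) (measurableSet_ball _ _)]
    · simp [measureReal_ball μ hμ]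
    · intro x hx
      rw [ball_zero_eq_level] at hx
      exact Dual.mem_annihilator.1 h x hx
  · exact integral_ball_val_eq_zero μ h

end Haar

end VilenkinGroup

/-! ### Digits of a character with respect to a Rademacher system -/

namespace VilenkinGroup

variable {p : ℕ}

namespace IsRademacher

variable {r : ℤ → Dual p} (hr : IsRademacher r)

include hr

/-- As `p` is prime, every `p`-th root of unity other than `1` is primitive; the value is not `1`
because `r_n ∉ G_n^⊥`. -/
theorem isPrimitiveRoot [hp : Fact p.Prime] (n : ℤ) :
    IsPrimitiveRoot ((r n).val (single n 1)) p := by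
  have h1 : (r n).val (single n 1) ≠ 1 := fun h =>
    hr.notMem n ((Dual.mem_annihilator_iff_val_single (hr.mem n)).2 h)
  have h2 := orderOf_eq_prime ((r n).val_pow_card (single n 1)) h1
  simpa only [h2] using IsPrimitiveRoot.orderOf ((r n).val (single n 1))

theorem pow_mul_inv_pow_mem_iff [hp : Fact p.Prime] {n : ℤ} {a b : ZMod p} :
    r n ^ a.val * (r n ^ b.val)⁻¹ ∈ Dual.annihilator p n ↔ a = b := by
  constructor
  · intro h
    rw [Dual.mem_annihilator] at h
    have h1 := h _ (single_mem_level n 1)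
    rw [Dual.val_mul, Dual.val_inv] at h1
    have h2 : (r n ^ a.val).val (single n 1) = (r n ^ b.val).val (single n 1) := by
      rw [← mul_one ((r n ^ b.val).val _), ← h1, mul_left_comm, Dual.val_mul_conj, mul_one]
    rw [Dual.val_pow, Dual.val_pow] at h2
    exact ZMod.val_injective p
      ((hr.isPrimitiveRoot n).pow_inj (ZMod.val_lt a) (ZMod.val_lt b) h2)
  · rintro rfl
    rw [mul_inv_cancel]
    exact one_mem _

/-- Modulo `G_n^⊥`, `χ` is determined by its value at `single n 1`, which is a power of the
primitive root given by `r_n`. -/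
theorem exists_digit [hp : Fact p.Prime] {n : ℤ} {χ : Dual p}
    (hχ : χ ∈ Dual.annihilator p (n + 1)) :
    ∃ a : ZMod p, χ * (r n ^ a.val)⁻¹ ∈ Dual.annihilator p n := by
  obtain ⟨i, hi, h⟩ := (hr.isPrimitiveRoot n).eq_pow_of_pow_eq_one (χ.val_pow_card (single n 1))
  refine ⟨(i : ZMod p), ?_⟩
  rw [Dual.mem_annihilator_iff_val_single (mul_mem hχ (inv_mem (pow_mem (hr.mem n) _))),
    ZMod.val_cast_of_lt hi, Dual.val_mul, Dual.val_inv, Dual.val_pow, h,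
    Dual.val_mul_conj]

theorem dilate_eq (n k : ℤ) : Dual.dilate k (r n) = r (n + k) := by
  induction k using Int.induction_on with
  | zero => rw [Dual.dilate_zero, add_zero]
  | succ k ih => rw [add_comm (k : ℤ) 1, ← Dual.dilate_dilate, ih, hr.dilate, add_assoc, add_comm 1]
  | pred k ih =>
    have h : Dual.dilate (-1) (r (n + -(k : ℤ))) = r (n + (-(k : ℤ) - 1)) := by
      have := hr.dilate (n + (-(k : ℤ) - 1))
      rw [show n + (-(k : ℤ) - 1) + 1 = n + -(k : ℤ) by ring] at this
      rw [← this, Dual.dilate_dilate, neg_add_cancel, Dual.dilate_zero]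
    rw [← h, ← ih, Dual.dilate_dilate]
    congr 1
    ring

end IsRademacher

/-- The product `r_n^{a_n} ⋯ r_{n+m-1}^{a_{n+m-1}}`. -/
noncomputable def digitProd (r : ℤ → Dual p) (a : ℤ → ZMod p) (n : ℤ) (m : ℕ) : Dual p :=
  ∏ i ∈ Finset.range m, r (n + i) ^ (a (n + i)).val

theorem digitProd_succ (r : ℤ → Dual p) (a : ℤ → ZMod p) (n : ℤ) (m : ℕ) :
    digitProd r a n (m + 1) = digitProd r a n m * r (n + m) ^ (a (n + m)).val :=
  Finset.prod_range_succ _ _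

theorem digitProd_congr (r : ℤ → Dual p) {a b : ℤ → ZMod p} {n : ℤ} {m : ℕ}
    (h : ∀ i < m, a (n + i) = b (n + i)) : digitProd r a n m = digitProd r b n m :=
  Finset.prod_congr rfl fun i hi => by rw [h i (Finset.mem_range.1 hi)]

/-- `χ ∈ G_n^⊥ r_n^{a_n} r_{n+1}^{a_{n+1}} ⋯`, where almost all digits are zero. -/
def HasDigits (r : ℤ → Dual p) (n : ℤ) (χ : Dual p) (a : ℤ → ZMod p) : Prop :=
  ∃ M : ℕ, (∀ j : ℤ, n + M ≤ j → a j = 0) ∧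
    ∀ m, M ≤ m → χ * (digitProd r a n m)⁻¹ ∈ Dual.annihilator p n

theorem digitProd_eq_of_le [NeZero p] (r : ℤ → Dual p) {a : ℤ → ZMod p} {n : ℤ} {M m : ℕ}
    (ha : ∀ j : ℤ, n + M ≤ j → a j = 0) (hm : M ≤ m) : digitProd r a n m = digitProd r a n M := by
  induction m, hm using Nat.le_induction with
  | base => rfl
  | succ m hm ih =>
    rw [digitProd_succ, ih, ha _ (by omega), ZMod.val_zero, pow_zero, mul_one]

theorem HasDigits.of_mem [NeZero p] {r : ℤ → Dual p} {n : ℤ} {χ : Dual p} {a : ℤ → ZMod p} {M : ℕ}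
    (ha : ∀ j : ℤ, n + M ≤ j → a j = 0)
    (h : χ * (digitProd r a n M)⁻¹ ∈ Dual.annihilator p n) : HasDigits r n χ a :=
  ⟨M, ha, fun m hm => by rwa [digitProd_eq_of_le r ha hm]⟩

theorem HasDigits.mul_of_mem {r : ℤ → Dual p} {n : ℤ} {χ η : Dual p} {a : ℤ → ZMod p}
    (h : HasDigits r n χ a) (hη : η ∈ Dual.annihilator p n) : HasDigits r n (χ * η) a := by
  obtain ⟨M, h1, h2⟩ := h
  refine ⟨M, h1, fun m hm => ?_⟩
  rw [mul_right_comm]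
  exact mul_mem (h2 m hm) hη

namespace IsRademacher

variable {r : ℤ → Dual p} (hr : IsRademacher r)

include hr

theorem digitProd_mem (a : ℤ → ZMod p) (n : ℤ) (m : ℕ) :
    digitProd r a n m ∈ Dual.annihilator p (n + m) :=
  prod_mem fun i hi => pow_mem (Dual.annihilator_mono
    (by have := Finset.mem_range.1 hi; omega) (hr.mem _)) _

theorem exists_digits_of_mem [hp : Fact p.Prime] (n : ℤ) (m : ℕ) {χ : Dual p}
    (hχ : χ ∈ Dual.annihilator p (n + m)) :
    ∃ a : ℤ → ZMod p, (∀ j, n + m ≤ j → a j = 0) ∧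
      χ * (digitProd r a n m)⁻¹ ∈ Dual.annihilator p n := by
  induction m generalizing χ with
  | zero => exact ⟨0, fun _ _ => rfl, by simpa [digitProd] using hχ⟩
  | succ m ih =>
    obtain ⟨d, hd⟩ := hr.exists_digit (n := n + m) (by simpa [add_assoc] using hχ)
    obtain ⟨a, ha, h⟩ := ih hd
    refine ⟨Function.update a (n + m) d, fun j hj => ?_, ?_⟩
    · push_cast at hj
      rw [Function.update_of_ne (by omega), ha j (by omega)]
    · rw [digitProd_succ, Function.update_self,
        digitProd_congr r (b := a) fun i hi => Function.update_of_ne (by omega) _ _, mul_inv,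
        mul_comm (digitProd r a n m)⁻¹, ← mul_assoc]
      exact h

theorem exists_hasDigits [hp : Fact p.Prime] (n : ℤ) (χ : Dual p) :
    ∃ a, HasDigits r n χ a := by
  obtain ⟨L, hL⟩ := χ.exists_mem_annihilator
  obtain ⟨a, ha, h⟩ := hr.exists_digits_of_mem n (L - n).toNat
    (Dual.annihilator_mono (by omega : L ≤ n + (L - n).toNat) hL)
  exact ⟨a, HasDigits.of_mem ha h⟩

/-- The top digit comes first: the lower factors lie in `G_{n+m}^⊥` and drop out modulo that group.
-/
theorem digits_eq_of_mem [hp : Fact p.Prime] {a b : ℤ → ZMod p} {n : ℤ} {m : ℕ}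
    (h : digitProd r a n m * (digitProd r b n m)⁻¹ ∈ Dual.annihilator p n) :
    ∀ i < m, a (n + i) = b (n + i) := by
  induction m with
  | zero => simp
  | succ m ih =>
    have h1 := mul_mem (hr.digitProd_mem a n m) (inv_mem (hr.digitProd_mem b n m))
    rw [digitProd_succ, digitProd_succ, mul_inv, mul_mul_mul_comm] at h
    have h2 : a (n + m) = b (n + m) := by
      rw [← hr.pow_mul_inv_pow_mem_iff]
      exact ((Dual.annihilator p (n + m)).mul_mem_cancel_left h1).1
        (Dual.annihilator_mono (by omega) h)
    intro i hi
    rcases Nat.lt_succ_iff_lt_or_eq.1 hi with hi | rfl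
    · rw [h2, mul_inv_cancel, mul_one] at h
      exact ih h i hi
    · exact h2

theorem hasDigits_unique [hp : Fact p.Prime] {n : ℤ} {χ : Dual p} {a b : ℤ → ZMod p}
    (ha : HasDigits r n χ a) (hb : HasDigits r n χ b) {j : ℤ} (hj : n ≤ j) : a j = b j := by
  obtain ⟨M, -, h1⟩ := ha
  obtain ⟨M', -, h2⟩ := hb
  -- Long enough for both expansions to be complete and for `j` to be among the digits.
  set m := max (max M M') ((j - n).toNat + 1)
  have h := mul_mem (inv_mem (h1 m (by omega))) (h2 m (by omega))
  have h' : digitProd r a n m * (digitProd r b n m)⁻¹ ∈ Dual.annihilator p n := by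
    convert h using 1
    rw [mul_inv, inv_inv, mul_mul_mul_comm, inv_mul_cancel, one_mul]
  have := hr.digits_eq_of_mem h' (j - n).toNat (by omega)
  rwa [show n + ((j - n).toNat : ℤ) = j by omega] at this

theorem hasDigits_mono {n n' : ℤ} (hn : n ≤ n') {χ : Dual p} {a : ℤ → ZMod p}
    (h : HasDigits r n χ a) : HasDigits r n' χ a := by
  induction n', hn using Int.leInduction with
  | base => exact h
  | succ n' hn ih =>
    obtain ⟨M, h1, h2⟩ := ih
    refine ⟨M, fun j hj => h1 j (by omega), fun m hm => ?_⟩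
    -- The digit at `n'` is given back to the character: `r_{n'}` lies in `G_{n'+1}^⊥`. One extra
    -- digit at the start leaves `m` of them.
    have h3 := mul_mem (Dual.annihilator_mono (by omega : n' ≤ n' + 1) (h2 (m + 1) (by omega)))
      (pow_mem (hr.mem n') (a n').val)
    convert h3 using 1
    simp only [digitProd, Finset.prod_range_succ', Nat.cast_add, Nat.cast_one, Nat.cast_zero,
      add_zero, mul_inv, add_assoc, add_comm (1 : ℤ)]
    rw [mul_assoc, mul_assoc, inv_mul_cancel, mul_one]

/-- Since `r_n 𝒜 = r_{n+1}`, dilation shifts digits; this turns the factors of `φ̂` into windows of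
one sequence. -/
theorem hasDigits_dilate {n : ℤ} {χ : Dual p} {a : ℤ → ZMod p} (h : HasDigits r n χ a) (k : ℤ) :
    HasDigits r (n - k) (Dual.dilate (-k) χ) fun j => a (j + k) := by
  obtain ⟨M, h1, h2⟩ := h
  refine ⟨M, fun j hj => h1 _ (by omega), fun m hm => ?_⟩
  have h3 := h2 m hm
  rw [show Dual.annihilator p n = Dual.annihilator p (n - k - -k) by ring_nf,
    ← Dual.dilate_mem_annihilator, ← Dual.dilateHom_apply, map_mul, map_inv] at h3
  have h4 : Dual.dilateHom p (-k) (digitProd r a n m) =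
      digitProd r (fun j => a (j + k)) (n - k) m := by
    rw [digitProd, digitProd, map_prod]
    refine Finset.prod_congr rfl fun i _ => ?_
    rw [map_pow, Dual.dilateHom_apply, hr.dilate_eq, show n - k + i = n + i + -k by ring,
      neg_add_cancel_right]
  rwa [h4] at h3

theorem mem_annihilator_of_hasDigits [hp : Fact p.Prime] {n L : ℤ} (hn : n ≤ L) {χ : Dual p}
    {a : ℤ → ZMod p} (h : HasDigits r n χ a) (ha : ∀ j, L ≤ j → a j = 0) :
    χ ∈ Dual.annihilator p L := by
  obtain ⟨M, h1, h2⟩ := hr.hasDigits_mono hn h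
  have h3 := h2 M le_rfl
  rw [digitProd_eq_of_le (M := 0) r (fun j hj => ha j (by simpa using hj)) (Nat.zero_le M)] at h3
  simpa [digitProd] using h3

end IsRademacher

end VilenkinGroup

/-! ### The refinable function of an `N`-valid tree -/

namespace LabelledTree

variable {p : ℕ} {T : LabelledTree.{u} p} {N : ℕ}

theorem level_iterate_parent {v : T.V} {i : ℕ} (hi : i ≤ T.level v) :
    T.level (T.parent^[i] v) + i = T.level v := by
  induction i with
  | zero => simp
  | succ i ih =>
    have h := ih (by omega)
    rw [Function.iterate_succ_apply']
    have := T.level_parent (T.parent^[i] v) fun h0 => by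
      have := (T.level_eq_zero_iff _).2 h0
      omega
    omega

/-- The strict descent behind the compact support of `φ̂`. -/
theorem GraphEdge.level_lt {v w : T.V} (h : T.GraphEdge N v w) : T.level w < T.level v := by
  rcases h with ⟨h1, rfl⟩ | h
  · have := T.level_parent v h1
    omega
  · exact h.2.1

theorem GraphEdge.label_eq {v w : T.V} (h : T.GraphEdge N v w) {i : ℕ} (hi : i + 1 < N) :
    T.label (T.parent^[i] w) = T.label (T.parent^[i + 1] v) := by
  rcases h with ⟨h1, rfl⟩ | h
  · rw [Function.iterate_succ_apply]
  · exact h.2.2.2 i hi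

/-- The labels on a path of the graph are those on the path of the tree with the same start. -/
theorem label_iterate_parent_eq {c : ℕ → T.V} (hc : ∀ i < N, T.GraphEdge N (c i) (c (i + 1)))
    {i j : ℕ} (hi : i < N) (hij : j + i ≤ N) :
    T.label (T.parent^[i] (c j)) = T.label (c (j + i)) := by
  induction i generalizing j with
  | zero => rfl
  | succ i ih =>
    rw [← (hc j (by omega)).label_eq hi, ih (by omega) (by omega), add_right_comm, add_assoc]

/-- Each edge costs at least one level, so a path with `N` edges starts at level `N` or more. This
guarantees that the tree paths to be compared exist. -/
theorem le_level_add {c : ℕ → T.V} (hc : ∀ i < N, T.GraphEdge N (c i) (c (i + 1))) {j : ℕ}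
    (hj : j ≤ N) : N ≤ T.level (c j) + j := by
  induction hj using Nat.decreasingInduction with
  | of_succ j hj ih =>
    have := (hc j hj).level_lt
    omega
  | self => omega

theorem InGraph.exists_path {α : Fin (N + 1) → ZMod p} (h : T.InGraph N α) :
    ∃ c : ℕ → T.V, (∀ i < N, T.GraphEdge N (c i) (c (i + 1))) ∧
      ∀ i : Fin (N + 1), T.label (c i) = α i := by
  obtain ⟨c, h1, h2⟩ := h
  refine ⟨fun i => c (Fin.ofNat (N + 1) i), fun i hi => ?_, fun i => ?_⟩
  · have e1 : Fin.ofNat (N + 1) i = (⟨i, hi⟩ : Fin N).castSucc :=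
      Fin.ext (Nat.mod_eq_of_lt (by omega))
    have e2 : Fin.ofNat (N + 1) (i + 1) = (⟨i, hi⟩ : Fin N).succ :=
      Fin.ext (Nat.mod_eq_of_lt (by omega))
    dsimp only
    rw [e1, e2]
    exact h1 ⟨i, hi⟩
  · rw [← h2]
    exact congrArg (fun j => T.label (c j)) (Fin.ext (Nat.mod_eq_of_lt i.2))

namespace IsValid

variable (hT : T.IsValid N)

include hT

theorem eq_of_label_eq {v w : T.V} (hv : N ≤ T.level v + 1) (hw : N ≤ T.level w + 1)
    (h : ∀ i < N, T.label (T.parent^[i] v) = T.label (T.parent^[i] w)) : v = w :=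
  (hT.2 fun i => T.label (T.parent^[i] w)).unique ⟨hv, fun i => h i i.2⟩ ⟨hw, fun _ => rfl⟩

/-- Vertices of level at least `N-1` inject into the finitely many words of length `N`. -/
theorem exists_level_le [NeZero p] : ∃ M, ∀ v, T.level v ≤ M := by
  have hfin : {v : T.V | N ≤ T.level v + 1}.Finite := by
    refine Set.Finite.of_finite_image (f := fun v (i : Fin N) => T.label (T.parent^[i] v))
      (Set.toFinite _) fun v hv w hw h => ?_
    exact hT.eq_of_label_eq hv hw fun i hi => congrFun h ⟨i, hi⟩
  obtain ⟨M, hM⟩ := (hfin.image T.level).bddAbove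
  refine ⟨max M N, fun v => ?_⟩
  by_cases hv : N ≤ T.level v + 1
  · exact le_max_of_le_left (hM ⟨v, hv, rfl⟩)
  · exact le_max_of_le_right (by omega)

/-- The only vertex of level at least `N - 1` at which a path with `N` zeros starts has level
`N - 1`. -/
theorem level_lt_of_label_eq_zero {v : T.V} (hv : N ≤ T.level v + 1)
    (h : ∀ i < N, T.label (T.parent^[i] v) = 0) : T.level v < N ∨ N = 0 := by
  by_contra! hN
  -- The ancestor of `v` at level `N-1` also starts a path of `N` zeros, so it equals `v` by
  -- uniqueness.
  set w := T.parent^[T.level v - (N - 1)] v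
  have hw : T.level w = N - 1 := by
    have := level_iterate_parent (T := T) (v := v) (i := T.level v - (N - 1)) (by omega)
    change T.level w + _ = _ at this
    omega
  have : v = w := hT.eq_of_label_eq hv (by omega) fun i hi => by
    rw [h i hi]
    refine (hT.1 _ (Or.inr ?_)).symm
    have := level_iterate_parent (T := T) (v := w) (i := i) (by omega)
    omega
  rw [← this] at hw
  omega

/-- If all windows of a sequence are zero or carried by the graph, then the sequence vanishes
from some place on, which depends on the tree only. -/
theorem eq_zero_of_windows (hN : 1 ≤ N) {M : ℕ} (hM : ∀ v, T.level v ≤ M) {w : ℕ → ZMod p}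
    (hw : ∀ k : ℕ, (fun i : Fin (N + 1) => w (i + k)) = 0 ∨
      T.InGraph N fun i : Fin (N + 1) => w (i + k)) {j : ℕ} (hj : N + M < j) : w j = 0 := by
  -- Invariant: window `k` is zero, or it is carried by a path whose start has level at most `M -
  -- k`.
  have key : ∀ k : ℕ, (∀ i ≤ N, w (i + k) = 0) ∨ ∃ c : ℕ → T.V,
      (∀ i < N, T.GraphEdge N (c i) (c (i + 1))) ∧ (∀ i ≤ N, T.label (c i) = w (i + k)) ∧
        T.level (c 0) + k ≤ M := by
    intro k
    induction k with
    | zero =>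
      rcases hw 0 with h | h
      · exact Or.inl fun i hi => congrFun h ⟨i, by omega⟩
      · obtain ⟨c, h1, h2⟩ := h.exists_path
        exact Or.inr ⟨c, h1, fun i hi => h2 ⟨i, by omega⟩, hM _⟩
    | succ k ih =>
      rcases hw (k + 1) with h | h
      · exact Or.inl fun i hi => congrFun h ⟨i, by omega⟩
      obtain ⟨c', h1', h2'⟩ := h.exists_path
      have h3' : ∀ i ≤ N, T.label (c' i) = w (i + (k + 1)) := fun i hi => h2' ⟨i, by omega⟩
      have hc' := le_level_add h1' (Nat.zero_le N)
      have h4' : ∀ i < N, T.label (T.parent^[i] (c' 0)) = w (i + (k + 1)) := fun i hi => by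
        rw [label_iterate_parent_eq h1' hi (by omega), zero_add, h3' i (by omega)]
      rcases ih with h0 | ⟨c, h1, h2, h3⟩
      -- After a zero window a carried one would begin with `N` zeros, forcing its start below level
      -- `N`; but such paths start at level `N` or more.
      · have := hT.level_lt_of_label_eq_zero (v := c' 0) (by omega) fun i hi => by
          rw [h4' i hi, ← add_assoc, add_right_comm, h0 _ (by omega)]
        omega
      · have hc := le_level_add h1 hN
        -- The two windows overlap in `N` labels, and these identify the vertex.
        have heq : c' 0 = c 1 := hT.eq_of_label_eq (by omega) (by omega) fun i hi => by
          rw [h4' i hi, label_iterate_parent_eq h1 hi (by omega), h2 _ (by omega)]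
          congr 1
          ring
        have := (h1 0 hN).level_lt
        refine Or.inr ⟨c', h1', h3', ?_⟩
        rw [heq]
        rw [zero_add] at this
        omega
  -- Here `k > M`, so only the zero alternative survives, and `j` is the last place of window `k`.
  obtain ⟨k, rfl⟩ : ∃ k, j = N + k := ⟨j - N, by omega⟩
  rcases key k with h | ⟨c, -, -, h⟩
  · exact h N le_rfl
  · omega

/-- The tree path from `v` to the root meets only zero labels after `v`. -/
theorem inGraph_of_level_eq {v : T.V} (hv : T.level v = N) :
    T.InGraph N fun i => if i = 0 then T.label v else 0 := by
  refine ⟨fun i => T.parent^[i] v, fun i => Or.inl ⟨fun h => ?_, ?_⟩, fun i => ?_⟩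
  · have h1 := (T.level_eq_zero_iff _).2 h
    have h2 := level_iterate_parent (T := T) (v := v) (i := i) (by omega)
    simp only [Fin.val_castSucc] at h1
    omega
  · simp [Function.iterate_succ_apply']
  · dsimp only
    split_ifs with hi
    · simp [hi]
    · refine hT.1 _ (Or.inr ?_)
      have h2 := level_iterate_parent (T := T) (v := v) (i := i) (by omega)
      have : (i : ℕ) ≠ 0 := fun h => hi (Fin.ext h)
      omega

end IsValid

open VilenkinGroup

/-! ### The mask and `φ̂` in terms of digits -/

section Mask

variable [hp : Fact p.Prime] {r : ℤ → Dual p} (hr : IsRademacher r)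

include hr

/-- By uniqueness of digits exactly one word `α` indexes a set containing `χ`. -/
theorem mask_eq {χ : Dual p} {a : ℤ → ZMod p} (ha : HasDigits r (-N) χ a) :
    T.mask N r χ = T.lam N fun i => a (-N + (i : ℕ)) := by
  have hprod : ∀ (l : ℕ) (b : ℤ → ZMod p),
      digitProd r b (-N) (N + 1 + l) =
        (∏ i : Fin (N + 1), r (-(N : ℤ) + (i : ℕ)) ^ (b (-N + (i : ℕ))).val) *
          ∏ j ∈ Finset.Icc 1 l, r (j : ℤ) ^ (b j).val := by
    intro l b
    rw [digitProd, Finset.prod_range_add, Fin.prod_univ_eq_prod_range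
      (fun i : ℕ => r (-(N : ℤ) + i) ^ (b (-N + i)).val)]
    congr 1
    rw [← Finset.Ico_add_one_right_eq_Icc, Finset.prod_Ico_eq_prod_range, Nat.add_sub_cancel]
    refine Finset.prod_congr rfl fun i _ => ?_
    have : -(N : ℤ) + ((N + 1 + i : ℕ) : ℤ) = ((1 + i : ℕ) : ℤ) := by
      push_cast
      ring
    rw [this]
  rw [mask, Finset.sum_eq_single fun i : Fin (N + 1) => a (-N + (i : ℕ)), if_pos]
  · obtain ⟨M, -, h2⟩ := ha
    have h3 := h2 (N + 1 + M) (by omega)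
    rw [hprod] at h3
    exact ⟨M, fun j => a j, h3⟩
  · intro α _ hα
    refine if_neg ?_
    rintro ⟨l, β, h⟩
    -- `α` on `-N, …, 0` and `β` on `1, …, l` are spliced into one expansion of `χ`, which must
    -- agree with `a`.
    set b : ℤ → ZMod p := fun j =>
      if h : 0 ≤ j + N ∧ j + N < N + 1 then α ⟨(j + N).toNat, by omega⟩
      else if 1 ≤ j ∧ j ≤ l then β j.toNat else 0 with hb
    have hb1 : ∀ i : Fin (N + 1), b (-N + (i : ℕ)) = α i := by
      intro i
      have := i.2
      rw [hb]
      dsimp only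
      rw [dif_pos (by omega)]
      congr 1
      ext
      simp
    have hb2 : ∀ j ∈ Finset.Icc 1 l, b (j : ℕ) = β j := by
      intro j hj
      rw [Finset.mem_Icc] at hj
      rw [hb]
      dsimp only
      rw [dif_neg (by omega), if_pos (by omega), Int.toNat_natCast]
    have hbd : HasDigits r (-N) χ b := by
      refine HasDigits.of_mem (M := N + 1 + l) (fun j hj => ?_) ?_
      · rw [hb]
        dsimp only
        rw [dif_neg (by omega), if_neg (by omega)]
      · rw [hprod]
        have e1 : ∏ j ∈ Finset.Icc 1 l, r (j : ℤ) ^ (b j).val =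
            ∏ j ∈ Finset.Icc 1 l, r (j : ℤ) ^ (β j).val :=
          Finset.prod_congr rfl fun j hj => by rw [hb2 j hj]
        rw [e1, Finset.prod_congr rfl fun i _ => by rw [hb1 i]]
        exact h
    refine hα (funext fun i => ?_)
    rw [← hb1 i]
    exact hr.hasDigits_unique hbd ha (by omega)
  · simp

open Classical in
theorem phiHat_eq {χ : Dual p} {a : ℤ → ZMod p} (ha : HasDigits r (-N) χ a) :
    T.phiHat N r χ = if ∀ k : ℕ, (fun i : Fin (N + 1) => a (-N + ((i + k : ℕ) : ℤ))) = 0 ∨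
      T.InGraph N (fun i : Fin (N + 1) => a (-N + ((i + k : ℕ) : ℤ))) then 1 else 0 := by
  have hmask : ∀ k : ℕ, T.mask N r (Dual.dilate (-(k : ℤ)) χ) =
      T.lam N fun i => a (-N + ((i + k : ℕ) : ℤ)) := by
    intro k
    rw [mask_eq hr (hr.hasDigits_mono (by omega) (hr.hasDigits_dilate ha k))]
    simp [add_assoc]
  simp_rw [phiHat, hmask]
  split_ifs with h
  · exact (tprod_congr fun k => if_pos (h k)).trans tprod_one
  · push Not at h
    obtain ⟨k, hk⟩ := h
    obtain ⟨M, hM, -⟩ := ha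
    -- Beyond `M` the windows are zero and the factors are `1`; the finite range also contains the
    -- vanishing factor `k`.
    rw [tprod_eq_prod (s := Finset.range (max M (k + 1)))]
    · refine Finset.prod_eq_zero (i := k) (by simp) (if_neg ?_)
      push Not
      exact hk
    · intro j hj
      rw [Finset.mem_range] at hj
      refine if_pos (Or.inl (funext fun i => hM _ ?_))
      push_cast
      omega

theorem phiHat_mul_of_mem {χ η : Dual p} (hη : η ∈ Dual.annihilator p (-N)) :
    T.phiHat N r (χ * η) = T.phiHat N r χ := by
  obtain ⟨a, ha⟩ := hr.exists_hasDigits (-N) χ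
  rw [phiHat_eq hr ha, phiHat_eq hr (ha.mul_of_mem hη)]

open Classical in
theorem IsValid.mem_annihilator_of_phiHat_ne_zero (hT : T.IsValid N) (hN : 1 ≤ N) {M : ℕ}
    (hM : ∀ v, T.level v ≤ M) {χ : Dual p} (hχ : T.phiHat N r χ ≠ 0) :
    χ ∈ Dual.annihilator p (M + 1) := by
  obtain ⟨a, ha⟩ := hr.exists_hasDigits (-N) χ
  rw [phiHat_eq hr ha, ite_ne_right_iff] at hχ
  have h := hχ.1
  refine hr.mem_annihilator_of_hasDigits (by omega) ha fun j hj => ?_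
  have := hT.eq_zero_of_windows hN hM (w := fun n : ℕ => a (-N + (n : ℤ))) h
    (j := (j + N).toNat) (by omega)
  rwa [show -(N : ℤ) + ((j + N).toNat : ℤ) = j by omega] at this

/-- Only the digit at `-N` can be nonzero, so only window `0` matters. It is `(a, 0, …, 0)`, carried
by the path from a vertex of level `N` labelled `a` to the root. -/
theorem IsValid.phiHat_eq_one (hT : T.IsValid N)
    (hTN : T.label '' {v | T.level v = N} = {a | a ≠ 0}) {χ : Dual p}
    (hχ : χ ∈ Dual.annihilator p (-N + 1)) : T.phiHat N r χ = 1 := by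
  obtain ⟨a, ha0, h⟩ := hr.exists_digits_of_mem (-N) 1 (by simpa using hχ)
  rw [phiHat_eq hr (HasDigits.of_mem ha0 h), if_pos]
  intro k
  rcases Nat.eq_zero_or_pos k with rfl | hk
  · by_cases h0 : a (-N) = 0
    · refine Or.inl (funext fun i => ?_)
      rcases Nat.eq_zero_or_pos (i : ℕ) with hi | hi
      · simpa [hi] using h0
      · exact ha0 _ (by push_cast; omega)
    · obtain ⟨v, hv, hva⟩ : a (-N) ∈ T.label '' {v | T.level v = N} := by
        rw [hTN]
        exact h0
      right
      convert hT.inGraph_of_level_eq hv using 2 with i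
      split_ifs with hi
      · simp [hi, hva]
      · have : (i : ℕ) ≠ 0 := fun h => hi (Fin.ext h)
        exact ha0 _ (by push_cast; omega)
  · exact Or.inl (funext fun i => ha0 _ (by push_cast; omega))

end Mask

end LabelledTree

/-! ### Fourier transforms of locally constant functions -/

namespace VilenkinGroup

variable {p : ℕ}

namespace Dual

theorem isOpen_coset (n : ℤ) (η : Dual p) : IsOpen {χ | χ * η⁻¹ ∈ annihilator p n} :=
  TopologicalSpace.isOpen_generateFrom_of_mem ⟨n, η, rfl⟩

theorem continuous_const_mul (θ : Dual p) : Continuous fun χ => θ * χ := by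
  refine continuous_generateFrom_iff.2 ?_
  rintro U ⟨n, η, rfl⟩
  convert isOpen_coset n (θ⁻¹ * η) using 1
  ext χ
  change θ * χ * η⁻¹ ∈ annihilator p n ↔ χ * (θ⁻¹ * η)⁻¹ ∈ annihilator p n
  rw [mul_inv, inv_inv, mul_comm θ χ, mul_assoc]

instance : MeasurableMul (Dual p) where
  measurable_const_mul θ := (continuous_const_mul θ).measurable
  measurable_mul_const θ := by
    simpa only [mul_comm] using (continuous_const_mul θ).measurable

variable (ν : Measure (Dual p)) [ν.IsHaarMeasure]

theorem measure_coset (n : ℤ) (η : Dual p) :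
    ν {χ | χ * η⁻¹ ∈ annihilator p n} = ν (annihilator p n : Set (Dual p)) := by
  rw [← measure_preimage_mul ν η⁻¹ (annihilator p n : Set (Dual p))]
  congr 1
  ext χ
  change χ * η⁻¹ ∈ annihilator p n ↔ η⁻¹ * χ ∈ annihilator p n
  rw [mul_comm]

/-- For `n ≤ 0` monotonicity suffices; the exact values of `ν` are never needed. -/
theorem measure_coset_lt_top (hν : ν (annihilator p 0 : Set (Dual p)) = 1) {n : ℤ} (hn : n ≤ 0)
    (η : Dual p) : ν {χ | χ * η⁻¹ ∈ annihilator p n} < ⊤ := by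
  rw [measure_coset]
  refine lt_of_le_of_lt (measure_mono (annihilator_mono hn)) ?_
  rw [hν]
  exact ENNReal.one_lt_top

theorem memLp_indicator_coset (hν : ν (annihilator p 0 : Set (Dual p)) = 1) {n : ℤ} (hn : n ≤ 0)
    (η : Dual p) (c : ℂ) :
    MemLp ({χ | χ * η⁻¹ ∈ annihilator p n}.indicator fun _ => c) 2 ν :=
  memLp_indicator_const _ (isOpen_coset n η).measurableSet _
    (Or.inr (measure_coset_lt_top ν hν hn η).ne)

end Dual

theorem memLp_indicator_ball [NeZero p] (μ : Measure (VilenkinGroup p)) [μ.IsAddHaarMeasure]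
    (hμ : μ (level p 0 : Set (VilenkinGroup p)) = 1) (s : ℤ) (h : VilenkinGroup p) (c : ℂ)
    (χ : Dual p) : MemLp ((ball s h).indicator fun x => c * χ.val x) 2 μ := by
  rw [memLp_indicator_iff_restrict (measurableSet_ball s h)]
  have : IsFiniteMeasure (μ.restrict (ball s h)) :=
    isFiniteMeasure_restrict.2 (measure_ball_lt_top μ hμ s h).ne
  exact MemLp.of_bound (χ.continuous_val.measurable.const_mul c).aestronglyMeasurable ‖c‖
    (ae_of_all _ fun x => by simp)

/-- The function `p^n 1_{G_n} η`, whose Fourier transform is the indicator of `G_n^⊥ η`. -/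
noncomputable def levelChar (n : ℤ) (η : Dual p) : VilenkinGroup p → ℂ :=
  (ball n 0).indicator fun x => (p : ℂ) ^ n * η.val x

/-- For the finite combinations used below, the truncated integrals are stationary. -/
theorem isFourierTransform_of_eventually_eq {μ : Measure (VilenkinGroup p)}
    {ν : Measure (Dual p)} {f : VilenkinGroup p → ℂ} {F : Dual p → ℂ} (hF : MemLp F 2 ν)
    (h : ∀ᶠ n : ℕ in atTop, ∀ χ : Dual p,
      ∫ x in (level p (-(n : ℤ)) : Set (VilenkinGroup p)), f x * conj (χ.val x) ∂μ = F χ) :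
    IsFourierTransform μ ν f F := by
  refine ⟨hF, tendsto_const_nhds.congr' ?_⟩
  filter_upwards [h] with n hn
  simp [hn]

section

variable (μ : Measure (VilenkinGroup p)) [μ.IsAddHaarMeasure]

theorem memLp_levelChar [NeZero p] (hμ : μ (level p 0 : Set (VilenkinGroup p)) = 1) (n : ℤ)
    (η : Dual p) : MemLp (levelChar n η) 2 μ :=
  memLp_indicator_ball μ hμ _ _ _ _

theorem integrableOn_levelChar_mul [NeZero p]
    (hμ : μ (level p 0 : Set (VilenkinGroup p)) = 1) (n m : ℤ) (η χ : Dual p) :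
    IntegrableOn (fun x => levelChar n η x * conj (χ.val x)) (level p m) μ := by
  have hfin : IsFiniteMeasure (μ.restrict (level p m : Set (VilenkinGroup p))) :=
    isFiniteMeasure_restrict.2
      (by rw [← ball_zero_eq_level]; exact (measure_ball_lt_top μ hμ m 0).ne)
  refine Integrable.mul_bdd (c := 1) ?_ ?_ (ae_of_all _ fun x => by simp)
  · exact ((memLp_levelChar μ hμ n η).restrict _).integrable one_le_two
  · exact (Complex.continuous_conj.comp χ.continuous_val).measurable.aestronglyMeasurable

/-- Orthogonality of characters on `G_n`; the factor `p^n` cancels `μ(G_n)`. -/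
theorem integral_levelChar [NeZero p] (hμ : μ (level p 0 : Set (VilenkinGroup p)) = 1)
    {n m : ℤ} (hm : m ≤ n) (η χ : Dual p) :
    ∫ x in (level p m : Set (VilenkinGroup p)), levelChar n η x * conj (χ.val x) ∂μ =
      {χ | χ * η⁻¹ ∈ Dual.annihilator p n}.indicator (fun _ => (1 : ℂ)) χ := by
  classical
  have h1 : ∀ x, levelChar n η x * conj (χ.val x) =
      (ball n 0).indicator (fun x => (p : ℂ) ^ n * (χ * η⁻¹)⁻¹.val x) x := by
    intro x
    rw [levelChar]
    by_cases hx : x ∈ ball n (0 : VilenkinGroup p)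
    · rw [Set.indicator_of_mem hx, Set.indicator_of_mem hx, mul_inv, inv_inv, Dual.val_mul,
        Dual.val_inv]
      ring
    · rw [Set.indicator_of_notMem hx, Set.indicator_of_notMem hx, zero_mul]
  have h2 : (level p m : Set (VilenkinGroup p)) ∩ ball n 0 = level p n := by
    rw [ball_zero_eq_level]
    exact Set.inter_eq_right.2 (level_antitone hm)
  simp_rw [h1]
  rw [setIntegral_indicator (measurableSet_ball n 0), h2, integral_const_mul,
    integral_level_val μ hμ, Set.indicator_apply]
  simp only [inv_mem_iff, Set.mem_ofPred_eq]
  split_ifs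
  · rw [← zpow_add₀ (by simp [NeZero.ne p]), add_neg_cancel, zpow_zero]
  · rw [mul_zero]

variable (ν : Measure (Dual p)) [ν.IsHaarMeasure]

theorem isFourierTransform_levelChar [NeZero p] (hμ : μ (level p 0 : Set (VilenkinGroup p)) = 1)
    (hν : ν (Dual.annihilator p 0 : Set (Dual p)) = 1) {n : ℤ} (hn : n ≤ 0) (η : Dual p) :
    IsFourierTransform μ ν (levelChar n η)
      ({χ | χ * η⁻¹ ∈ Dual.annihilator p n}.indicator fun _ => (1 : ℂ)) := by
  refine isFourierTransform_of_eventually_eq (Dual.memLp_indicator_coset ν hν hn η 1) ?_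
  filter_upwards [eventually_ge_atTop (-n).toNat] with k hk χ
  exact integral_levelChar μ hμ (by omega) η χ

/-- A function on the dual group which is constant on the cosets of `G_n^⊥` and vanishes outside
some `G_{n+m}^⊥` is the Fourier transform of a square integrable function. -/
theorem exists_isFourierTransform [hp : Fact p.Prime]
    (hμ : μ (level p 0 : Set (VilenkinGroup p)) = 1)
    (hν : ν (Dual.annihilator p 0 : Set (Dual p)) = 1) {r : ℤ → Dual p} (hr : IsRademacher r)
    {n : ℤ} (hn : n ≤ 0) (m : ℕ) {F : Dual p → ℂ}
    (hF : ∀ χ, ∀ η ∈ Dual.annihilator p n, F (χ * η) = F χ)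
    (hF0 : ∀ χ, F χ ≠ 0 → χ ∈ Dual.annihilator p (n + m)) :
    ∃ f, MemLp f 2 μ ∧ IsFourierTransform μ ν f F := by
  classical
  set q : Dual p → Dual p ⧸ Dual.annihilator p n := QuotientGroup.mk
  have hq : ∀ {χ η : Dual p}, χ * η⁻¹ ∈ Dual.annihilator p n ↔ q η = q χ := by
    intro χ η
    rw [mul_comm]
    exact QuotientGroup.eq.symm
  -- Characters in `G_{n+m}^⊥` have only `m` free digits modulo `G_n^⊥`.
  have hfin : (q '' (Dual.annihilator p (n + m))).Finite := by
    refine (Set.finite_range fun α : Fin m → ZMod p =>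
      q (∏ i : Fin m, r (n + (i : ℕ)) ^ (α i).val)).subset ?_
    rintro _ ⟨χ, hχ, rfl⟩
    obtain ⟨a, -, h⟩ := hr.exists_digits_of_mem n m hχ
    refine ⟨fun i => a (n + (i : ℕ)), ?_⟩
    dsimp only
    rw [← hq, Fin.prod_univ_eq_prod_range (fun i : ℕ => r (n + i) ^ (a (n + i)).val)]
    exact h
  set S := hfin.toFinset
  have hsum : F = fun χ => ∑ c ∈ S, F c.out *
      {χ | χ * c.out⁻¹ ∈ Dual.annihilator p n}.indicator (fun _ => (1 : ℂ)) χ := by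
    funext χ
    have hind : ∀ c : Dual p ⧸ Dual.annihilator p n,
        {χ | χ * c.out⁻¹ ∈ Dual.annihilator p n}.indicator (fun _ => (1 : ℂ)) χ =
          if c = q χ then 1 else 0 := by
      intro c
      rw [Set.indicator_apply]
      refine if_congr ?_ rfl rfl
      rw [Set.mem_ofPred_eq, hq, show q c.out = c from QuotientGroup.out_eq' c]
    simp_rw [hind, mul_ite, mul_one, mul_zero]
    rw [Finset.sum_ite_eq']
    have h1 : F (q χ).out = F χ := by
      obtain ⟨η, hη⟩ := QuotientGroup.mk_out_eq_mul (Dual.annihilator p n) χ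
      rw [show (q χ).out = χ * η from hη]
      exact hF χ η η.2
    split_ifs with h
    · exact h1.symm
    · by_contra h0
      exact h (hfin.mem_toFinset.2 ⟨χ, hF0 χ h0, rfl⟩)
  have hLp : MemLp F 2 ν := by
    rw [hsum]
    exact memLp_finsetSum _ fun c _ => (Dual.memLp_indicator_coset ν hν hn _ 1).const_mul _
  refine ⟨fun x => ∑ c ∈ S, F c.out * levelChar n c.out x,
    memLp_finsetSum _ fun c _ => (memLp_levelChar μ hμ n _).const_mul _,
    isFourierTransform_of_eventually_eq hLp ?_⟩
  filter_upwards [eventually_ge_atTop (-n).toNat] with k hk χ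
  refine Eq.trans ?_ (congrFun hsum χ).symm
  simp_rw [Finset.sum_mul, mul_assoc]
  rw [integral_finsetSum _ fun c _ => (integrableOn_levelChar_mul μ hμ _ _ _ _).const_mul _]
  refine Finset.sum_congr rfl fun c _ => ?_
  rw [integral_const_mul, integral_levelChar μ hμ (by omega)]

end

end VilenkinGroup

/-! ### Fourier analysis on `ℤ/p` -/

/-- The substitution `j ↦ j + 1` shows that the sum is fixed under multiplication by `z`. -/
theorem ZMod.sum_pow_val_of_ne_one {p : ℕ} [hp : Fact p.Prime] {z : ℂ} (hz : z ^ p = 1)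
    (h1 : z ≠ 1) : ∑ j : ZMod p, z ^ j.val = 0 := by
  have h : z * ∑ j : ZMod p, z ^ j.val = ∑ j : ZMod p, z ^ j.val := by
    rw [Finset.mul_sum]
    refine Fintype.sum_equiv (Equiv.addRight 1) _ _ fun j => ?_
    rw [Equiv.coe_addRight, ZMod.val_add, ← pow_eq_pow_mod _ hz, ZMod.val_one, pow_succ']
  have h2 : (z - 1) * ∑ j : ZMod p, z ^ j.val = 0 := by rw [sub_mul, h, one_mul, sub_self]
  exact (mul_eq_zero.1 h2).resolve_left (sub_ne_zero.2 h1)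

section FiniteFourier

variable {p : ℕ} [hp : Fact p.Prime] {v : ZMod p → ℂ} (hv : ∀ d, v d ^ p = 1)
  (hinj : Function.Injective v) (F : ZMod p → ℂ)

include hv hinj

/-- Fourier inversion: for `d' ≠ d` injectivity makes `conj (v d') * v d` a nontrivial `p`-th root
of unity, so its powers sum to zero. -/
theorem ZMod.sum_mul_pow_val (d : ZMod p) :
    ∑ j : ZMod p, (∑ d', conj (v d') ^ j.val * F d') * v d ^ j.val = p * F d := by
  have hv' : ∀ d, v d * conj (v d) = 1 := fun d => by
    rw [Complex.mul_conj', Complex.norm_eq_one_of_pow_eq_one (hv d) hp.out.ne_zero]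
    simp
  have hmul : ∀ (d' : ZMod p) (j : ℕ),
      conj (v d') ^ j * F d' * v d ^ j = (conj (v d') * v d) ^ j * F d' := fun d' j => by
    rw [mul_pow]
    ring
  simp_rw [Finset.sum_mul, hmul]
  rw [Finset.sum_comm, Finset.sum_eq_single d]
  · simp_rw [mul_comm (conj _), hv', one_pow, one_mul]
    simp [ZMod.card]
  · intro d' _ hd'
    rw [← Finset.sum_mul, ZMod.sum_pow_val_of_ne_one, zero_mul]
    · rw [mul_pow, ← map_pow, hv, hv, map_one, one_mul]
    · intro h
      refine hd' (hinj ?_)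
      rw [← mul_one (v d'), ← h, ← mul_assoc, hv', one_mul]
  · simp

/-- Parseval, obtained by expanding one factor and applying the inversion formula. -/
theorem ZMod.sum_norm_sq_eq :
    ∑ j : ZMod p, ‖∑ d, conj (v d) ^ j.val * F d‖ ^ 2 = p * ∑ d, ‖F d‖ ^ 2 := by
  have h : ((∑ j : ZMod p, ‖∑ d, conj (v d) ^ j.val * F d‖ ^ 2 : ℝ) : ℂ) =
      ((p * ∑ d, ‖F d‖ ^ 2 : ℝ) : ℂ) := by
    push_cast
    simp_rw [← Complex.mul_conj']
    calc ∑ j : ZMod p, (∑ d, conj (v d) ^ j.val * F d) * conj (∑ d, conj (v d) ^ j.val * F d)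
        = ∑ j : ZMod p, ∑ d, (∑ d', conj (v d') ^ j.val * F d') * v d ^ j.val * conj (F d) := by
          refine Finset.sum_congr rfl fun j _ => ?_
          rw [map_sum, Finset.mul_sum]
          refine Finset.sum_congr rfl fun d _ => ?_
          rw [map_mul, map_pow, Complex.conj_conj, mul_assoc]
      _ = ∑ d, p * F d * conj (F d) := by
          rw [Finset.sum_comm]
          refine Finset.sum_congr rfl fun d _ => ?_
          rw [← Finset.sum_mul, ZMod.sum_mul_pow_val hv hinj]
      _ = _ := by
          rw [Finset.mul_sum]
          simp_rw [mul_assoc]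
  exact_mod_cast h

end FiniteFourier

/-! ### Haar wavelets on the Vilenkin group -/

namespace VilenkinGroup

variable {p : ℕ}

/-- The value of `r_s` on a ball of radius `s + 1` in the ball of index `h` and radius `s`. -/
noncomputable def childVal (r : ℤ → Dual p) (s : ℤ) (h : shifts p) (d : ZMod p) : ℂ :=
  (r s).val (dilation p (-(s + 1)) (shiftsEquiv p (d, h) : VilenkinGroup p))

theorem mem_ball_shiftsEquiv_iff {s : ℤ} {h : shifts p} {d : ZMod p} {x : VilenkinGroup p} :
    x ∈ ball (s + 1) (shiftsEquiv p (d, h) : VilenkinGroup p) ↔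
      x ∈ ball s (h : VilenkinGroup p) ∧ x.coord s = d := by
  rw [mem_ball_shifts_iff, mem_ball_shifts_iff, ← Equiv.symm_apply_eq, Prod.ext_iff, and_comm]
  refine and_congr ?_ ?_
  · change center (-1) (center (s + 1) x : VilenkinGroup p) = h ↔ _
    rw [center_center _ _ (by omega), neg_add_cancel_comm_assoc]
  · change (center (s + 1) x : VilenkinGroup p).coord (-1) = d ↔ _
    simp [center, coord_truncate]

theorem ball_eq_iUnion (s : ℤ) (h : shifts p) : ball s (h : VilenkinGroup p) =
    ⋃ d, ball (s + 1) (shiftsEquiv p (d, h) : VilenkinGroup p) := by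
  ext x
  simp [mem_ball_shiftsEquiv_iff]

theorem disjoint_ball {s : ℤ} {h h' : shifts p} (hh : h ≠ h') :
    Disjoint (ball s (h : VilenkinGroup p)) (ball s (h' : VilenkinGroup p)) :=
  Set.disjoint_left.2 fun _ hx hx' =>
    hh ((mem_ball_shifts_iff.1 hx).symm.trans (mem_ball_shifts_iff.1 hx'))

theorem childVal_pow (r : ℤ → Dual p) (s : ℤ) (h : shifts p) (d : ZMod p) :
    childVal r s h d ^ p = 1 :=
  Dual.val_pow_card _ _

/-- The ratio of two values is a power of the primitive root with exponent `d - d'`. -/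
theorem IsRademacher.childVal_injective [hp : Fact p.Prime] {r : ℤ → Dual p}
    (hr : IsRademacher r) (s : ℤ) (h : shifts p) : Function.Injective (childVal r s h) := by
  intro d d' hdd
  have hx := mem_ball_shiftsEquiv_iff.1
    (dilation_neg_mem_ball (s + 1) (shiftsEquiv p (d, h) : VilenkinGroup p))
  have hy := mem_ball_shiftsEquiv_iff.1
    (dilation_neg_mem_ball (s + 1) (shiftsEquiv p (d', h) : VilenkinGroup p))
  rw [childVal, childVal] at hdd
  set x := dilation p (-(s + 1)) (shiftsEquiv p (d, h) : VilenkinGroup p)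
  set y := dilation p (-(s + 1)) (shiftsEquiv p (d', h) : VilenkinGroup p)
  have h1 := Dual.val_eq_of_mem_annihilator (hr.mem s) ((mem_ball_iff_sub_mem hy.1).1 hx.1)
  rw [Dual.val_sub, hdd, Dual.val_mul_conj, coord_sub, hx.2, hy.2] at h1
  have h2 := (hr.isPrimitiveRoot s).dvd_of_pow_eq_one _ h1.symm
  have h3 := Nat.eq_zero_of_dvd_of_lt h2 (ZMod.val_lt _)
  exact sub_eq_zero.1 ((ZMod.val_eq_zero _).1 h3)

section

variable (μ : Measure (VilenkinGroup p)) [μ.IsAddHaarMeasure]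

theorem integrableOn_ball_mul_conj [NeZero p] (hμ : μ (level p 0 : Set (VilenkinGroup p)) = 1)
    {f : VilenkinGroup p → ℂ} (hf : MemLp f 2 μ) (s : ℤ) (h : VilenkinGroup p) (χ : Dual p) :
    IntegrableOn (fun x => f x * conj (χ.val x)) (ball s h) μ := by
  have : IsFiniteMeasure (μ.restrict (ball s h)) :=
    isFiniteMeasure_restrict.2 (measure_ball_lt_top μ hμ s h).ne
  refine Integrable.mul_bdd (c := 1) ((hf.restrict _).integrable one_le_two) ?_
    (ae_of_all _ fun x => by simp)
  exact (Complex.continuous_conj.comp χ.continuous_val).measurable.aestronglyMeasurable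

/-- `r_s` is constant on each of the `p` parts of the ball, so its powers produce the discrete
Fourier transform of the integrals over the parts. -/
theorem IsRademacher.setIntegral_ball_eq_sum [hp : Fact p.Prime]
    (hμ : μ (level p 0 : Set (VilenkinGroup p)) = 1) {r : ℤ → Dual p} (hr : IsRademacher r)
    {f : VilenkinGroup p → ℂ} (hf : MemLp f 2 μ) (s : ℤ) (h : shifts p) (m : ℕ) (χ : Dual p) :
    ∫ x in ball s (h : VilenkinGroup p), f x * conj ((r s ^ m * χ).val x) ∂μ =
      ∑ d, conj (childVal r s h d) ^ m *
        ∫ x in ball (s + 1) (shiftsEquiv p (d, h) : VilenkinGroup p), f x * conj (χ.val x) ∂μ := by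
  have h1 := integrableOn_ball_mul_conj μ hμ hf s h (r s ^ m * χ)
  rw [ball_eq_iUnion, integral_iUnion_fintype]
  · refine Finset.sum_congr rfl fun d _ => ?_
    rw [← integral_const_mul]
    refine setIntegral_congr_fun (measurableSet_ball _ _) fun x hx => ?_
    rw [Dual.val_mul, Dual.val_pow, map_mul, map_pow,
      Dual.val_eq_of_mem_ball (hr.mem s) hx (dilation_neg_mem_ball _ _), childVal]
    ring
  · exact fun d => measurableSet_ball _ _
  · exact fun d d' hdd => disjoint_ball fun h0 =>
      hdd (congrArg Prod.fst ((shiftsEquiv p).injective h0))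
  · exact fun d => h1.mono_set fun x hx => (mem_ball_shiftsEquiv_iff.1 hx).1

/-- The energy of `f` on the balls of radius `s`, relative to the character `χ`. -/
noncomputable def energy (f : VilenkinGroup p → ℂ) (s : ℤ) (χ : Dual p) : ENNReal :=
  ∑' h : shifts p, ENNReal.ofReal
    ((p : ℝ) ^ s * ‖∫ x in ball s (h : VilenkinGroup p), f x * conj (χ.val x) ∂μ‖ ^ 2)

/-- Parseval on `ℤ/p` in every ball; its factor `p` raises the weight `p^s` to `p^{s+1}`. -/
theorem IsRademacher.sum_energy [hp : Fact p.Prime]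
    (hμ : μ (level p 0 : Set (VilenkinGroup p)) = 1) {r : ℤ → Dual p} (hr : IsRademacher r)
    {f : VilenkinGroup p → ℂ} (hf : MemLp f 2 μ) (s : ℤ) (χ : Dual p) :
    ∑ j : ZMod p, energy μ f s (r s ^ j.val * χ) = energy μ f (s + 1) χ := by
  have hp0 : (p : ℝ) ≠ 0 := by simp [hp.out.ne_zero]
  simp_rw [energy]
  rw [← (shiftsEquiv p).tsum_eq, ← (Equiv.prodComm _ _).tsum_eq, ENNReal.tsum_prod',
    ← Summable.tsum_finsetSum fun _ _ => ENNReal.summable]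
  refine tsum_congr fun h => ?_
  simp only [Equiv.prodComm_apply, Prod.swap_prod_mk, tsum_fintype]
  rw [← ENNReal.ofReal_sum_of_nonneg fun _ _ => by positivity,
    ← ENNReal.ofReal_sum_of_nonneg fun _ _ => by positivity, ← Finset.mul_sum, ← Finset.mul_sum]
  simp_rw [hr.setIntegral_ball_eq_sum μ hμ hf]
  rw [ZMod.sum_norm_sq_eq (childVal_pow r s h) (hr.childVal_injective s h), ← mul_assoc,
    zpow_add_one₀ hp0]

end

end VilenkinGroup

/-! ### The Haar wavelets as an orthonormal basis -/

namespace VilenkinGroup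

variable {p : ℕ}

/-- The Haar wavelet with the character `r_s^k` on the ball of index `h` and radius `s`. -/
noncomputable def haarWavelet (r : ℤ → Dual p) (i : {k : ZMod p // k ≠ 0} × ℤ × shifts p) :
    VilenkinGroup p → ℂ :=
  (ball i.2.1 (i.2.2 : VilenkinGroup p)).indicator fun x =>
    ((√((p : ℝ) ^ i.2.1) : ℝ) : ℂ) * (r i.2.1 ^ i.1.1.val).val x

theorem integral_mul_conj_haarWavelet (μ : Measure (VilenkinGroup p)) (r : ℤ → Dual p)
    (f : VilenkinGroup p → ℂ) (i : {k : ZMod p // k ≠ 0} × ℤ × shifts p) :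
    ∫ x, f x * conj (haarWavelet r i x) ∂μ = ((√((p : ℝ) ^ i.2.1) : ℝ) : ℂ) *
      ∫ x in ball i.2.1 (i.2.2 : VilenkinGroup p), f x * conj ((r i.2.1 ^ i.1.1.val).val x) ∂μ := by
  rw [← integral_const_mul, ← integral_indicator (measurableSet_ball _ _)]
  refine integral_congr_ae (ae_of_all _ fun x => ?_)
  dsimp only [haarWavelet]
  by_cases hx : x ∈ ball i.2.1 (i.2.2 : VilenkinGroup p)
  · rw [Set.indicator_of_mem hx, Set.indicator_of_mem hx, map_mul, Complex.conj_ofReal]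
    ring
  · rw [Set.indicator_of_notMem hx, Set.indicator_of_notMem hx, map_zero, mul_zero]

theorem integral_haarWavelet_mul_conj (μ : Measure (VilenkinGroup p)) (r : ℤ → Dual p)
    (i j : {k : ZMod p // k ≠ 0} × ℤ × shifts p) :
    ∫ x, haarWavelet r j x * conj (haarWavelet r i x) ∂μ =
      ((√((p : ℝ) ^ i.2.1) : ℝ) : ℂ) * ((√((p : ℝ) ^ j.2.1) : ℝ) : ℂ) *
        ∫ x in ball i.2.1 (i.2.2 : VilenkinGroup p) ∩ ball j.2.1 (j.2.2 : VilenkinGroup p),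
          (r j.2.1 ^ j.1.1.val * (r i.2.1 ^ i.1.1.val)⁻¹).val x ∂μ := by
  rw [integral_mul_conj_haarWavelet, mul_assoc, ← setIntegral_indicator (measurableSet_ball _ _),
    ← integral_const_mul (((√((p : ℝ) ^ j.2.1) : ℝ) : ℂ))]
  congr 2
  funext x
  dsimp only [haarWavelet]
  by_cases hx : x ∈ ball j.2.1 (j.2.2 : VilenkinGroup p)
  · rw [Set.indicator_of_mem hx, Set.indicator_of_mem hx, Dual.val_mul, Dual.val_inv, mul_assoc]
  · rw [Set.indicator_of_notMem hx, Set.indicator_of_notMem hx, zero_mul, mul_zero]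

section

variable (μ : Measure (VilenkinGroup p)) [μ.IsAddHaarMeasure]

theorem norm_setIntegral_ball_sq_le [NeZero p] (hμ : μ (level p 0 : Set (VilenkinGroup p)) = 1)
    (g : Lp ℂ 2 μ) (s : ℤ) (h : VilenkinGroup p) :
    ‖∫ x in ball s h, g x ∂μ‖ ^ 2 ≤ ‖g‖ ^ 2 * (p : ℝ) ^ (-s) := by
  have h1 := L2.inner_indicatorConstLp_one (𝕜 := ℂ) (measurableSet_ball s h)
    (measure_ball_lt_top μ hμ s h).ne g
  have h2 := norm_inner_le_norm (𝕜 := ℂ)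
    (indicatorConstLp 2 (measurableSet_ball s h) (measure_ball_lt_top μ hμ s h).ne (1 : ℂ)) g
  rw [h1, norm_indicatorConstLp two_ne_zero ENNReal.ofNat_ne_top, norm_one, one_mul,
    measureReal_ball μ hμ] at h2
  calc ‖∫ x in ball s h, g x ∂μ‖ ^ 2
      ≤ (((p : ℝ) ^ (-s)) ^ (1 / (2 : ENNReal).toReal) * ‖g‖) ^ 2 := by gcongr
    _ = ‖g‖ ^ 2 * (p : ℝ) ^ (-s) := by
      rw [mul_pow, mul_comm, ENNReal.toReal_ofNat, ← Real.sqrt_eq_rpow,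
        Real.sq_sqrt (by positivity)]

/-- A square integrable function whose integrals over all balls vanish is zero. -/
theorem eq_zero_of_setIntegral_ball_eq_zero [NeZero p]
    (hμ : μ (level p 0 : Set (VilenkinGroup p)) = 1) {g : VilenkinGroup p → ℂ} (hg : MemLp g 2 μ)
    (h0 : ∀ (s : ℤ) (h : shifts p), ∫ x in ball s (h : VilenkinGroup p), g x ∂μ = 0) :
    g =ᵐ[μ] 0 := by
  have hB : ∀ (s : ℤ) (h : shifts p), ∀ᵐ x ∂μ.restrict (ball s (h : VilenkinGroup p)), g x = 0 := by
    intro s h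
    have : IsFiniteMeasure (μ.restrict (ball s (h : VilenkinGroup p))) :=
      isFiniteMeasure_restrict.2 (measure_ball_lt_top μ hμ s h).ne
    have hint : Integrable g (μ.restrict (ball s (h : VilenkinGroup p))) :=
      (hg.restrict _).integrable one_le_two
    refine hint.ae_eq_zero_of_forall_setIntegral_eq_zero fun A hA hA' => ?_
    clear hA'
    -- Balls form a π-system generating the Borel sets, and an intersection of two balls is empty or
    -- again a ball.
    induction A, hA using
      MeasurableSpace.induction_on_inter (measurableSpace_eq_generateFrom_balls (p := p))
        isPiSystem_balls with
    | empty => simp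
    | basic A hA =>
      obtain ⟨⟨t, h'⟩, rfl⟩ := hA
      rw [Measure.restrict_restrict (measurableSet_ball _ _)]
      by_cases hne : (ball t (h' : VilenkinGroup p) ∩ ball s (h : VilenkinGroup p)).Nonempty
      · obtain ⟨⟨t', h''⟩, ht⟩ := isPiSystem_balls _ ⟨(t, h'), rfl⟩ _ ⟨(s, h), rfl⟩ hne
        dsimp only at ht ⊢
        rw [← ht]
        exact h0 _ _
      · rw [Set.not_nonempty_iff_eq_empty.1 hne, setIntegral_empty]
    | compl A hA ih =>
      have := integral_add_compl hA hint
      rwa [ih, zero_add, h0] at this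
    | iUnion A hd hA ih =>
      rw [integral_iUnion hA hd hint.integrableOn]
      simp [ih]
  have hU : ⋃ h : shifts p, ball 0 (h : VilenkinGroup p) = Set.univ :=
    Set.eq_univ_of_forall fun x => Set.mem_iUnion.2 ⟨center 0 x, mem_ball_shifts_iff.2 rfl⟩
  have := (ae_restrict_iUnion_iff (μ := μ) (fun h : shifts p => ball 0 (h : VilenkinGroup p))
    fun x => g x = 0).2 (hB 0)
  rwa [hU, Measure.restrict_univ] at this

/-- If the integral of `g` over each ball is equally distributed on its `p` parts, then all these
integrals vanish. -/
theorem setIntegral_ball_eq_zero [hp : Fact p.Prime]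
    (hμ : μ (level p 0 : Set (VilenkinGroup p)) = 1) (g : Lp ℂ 2 μ)
    (h0 : ∀ (s : ℤ) (h : shifts p) (d : ZMod p),
      p * ∫ x in ball (s + 1) (shiftsEquiv p (d, h) : VilenkinGroup p), g x ∂μ =
        ∫ x in ball s (h : VilenkinGroup p), g x ∂μ) (s : ℤ) (h : shifts p) :
    ∫ x in ball s (h : VilenkinGroup p), g x ∂μ = 0 := by
  have hp0 : (p : ℝ) ≠ 0 := by simp [hp.out.ne_zero]
  have hp1 : (1 : ℝ) < p := by exact_mod_cast hp.out.one_lt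
  -- Going up `m` radii multiplies the squared integral by `p^{2m}`, while the Cauchy–Schwarz bound
  -- grows only by `p^m`.
  have key : ∀ (m : ℕ) (s : ℤ) (h : shifts p), ‖∫ x in ball s (h : VilenkinGroup p), g x ∂μ‖ ^ 2 ≤
      ‖g‖ ^ 2 * (p : ℝ) ^ (-s) * (p : ℝ)⁻¹ ^ m := by
    intro m
    induction m with
    | zero =>
      intro s h
      simpa using norm_setIntegral_ball_sq_le μ hμ g s h
    | succ m ih =>
      intro s h
      obtain ⟨s, rfl⟩ : ∃ t, s = t + 1 := ⟨s - 1, by ring⟩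
      obtain ⟨⟨d, h⟩, rfl⟩ := (shiftsEquiv p).surjective h
      have h1 := ih s h
      rw [← h0 s h d, norm_mul, mul_pow, Complex.norm_natCast] at h1
      have h2 : (p : ℝ) ^ (-(s + 1)) = (p : ℝ) ^ (-s) * (p : ℝ)⁻¹ := by
        rw [neg_add, zpow_add₀ hp0, zpow_neg_one]
      have h3 : (0 : ℝ) < (p : ℝ) ^ 2 := by positivity
      rw [← mul_le_mul_iff_right₀ h3]
      refine h1.trans (le_of_eq ?_)
      rw [h2, inv_pow, inv_pow, pow_succ (p : ℝ)]
      field_simp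
      ring
  have hlim : Tendsto (fun m : ℕ => ‖g‖ ^ 2 * (p : ℝ) ^ (-s) * (p : ℝ)⁻¹ ^ m) atTop (𝓝 0) := by
    simpa using (tendsto_pow_atTop_nhds_zero_of_lt_one (by positivity)
      (inv_lt_one_of_one_lt₀ hp1)).const_mul (‖g‖ ^ 2 * (p : ℝ) ^ (-s))
  have h1 := ge_of_tendsto' hlim fun m => key m s h
  exact norm_eq_zero.1 (pow_eq_zero_iff two_ne_zero |>.1 (le_antisymm h1 (by positivity)))

theorem integral_inter_ball_eq_zero {s t : ℤ} (hst : s ≤ t) {h h' : VilenkinGroup p} {χ : Dual p}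
    (hχ : χ ∉ Dual.annihilator p t) : ∫ x in ball s h ∩ ball t h', χ.val x ∂μ = 0 := by
  rcases (ball s h ∩ ball t h').eq_empty_or_nonempty with h0 | ⟨x, hx, hx'⟩
  · rw [h0, setIntegral_empty]
  · rw [Set.inter_eq_right.2 (ball_subset_ball hst hx hx')]
    exact integral_ball_val_eq_zero μ hχ

theorem memLp_haarWavelet [NeZero p] (hμ : μ (level p 0 : Set (VilenkinGroup p)) = 1)
    (r : ℤ → Dual p) (i : {k : ZMod p // k ≠ 0} × ℤ × shifts p) : MemLp (haarWavelet r i) 2 μ :=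
  memLp_indicator_ball μ hμ _ _ _ _

variable [hp : Fact p.Prime] {r : ℤ → Dual p}

/-- The coarser character is constant on the support of the finer wavelet, whose mean is zero. -/
theorem IsRademacher.integral_haarWavelet_of_lt (hr : IsRademacher r)
    {i j : {k : ZMod p // k ≠ 0} × ℤ × shifts p} (hij : i.2.1 < j.2.1) :
    ∫ x, haarWavelet r j x * conj (haarWavelet r i x) ∂μ = 0 := by
  rw [integral_haarWavelet_mul_conj, integral_inter_ball_eq_zero μ hij.le, mul_zero]
  rw [Subgroup.mul_mem_cancel_right _ (inv_mem (pow_mem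
    (Dual.annihilator_mono (by omega : i.2.1 + 1 ≤ j.2.1) (hr.mem _)) _))]
  intro h
  refine j.1.2 ((hr.pow_mul_inv_pow_mem_iff (n := j.2.1) (b := 0)).1 ?_)
  rwa [ZMod.val_zero, pow_zero, inv_one, mul_one]

theorem IsRademacher.integral_haarWavelet (hr : IsRademacher r)
    (hμ : μ (level p 0 : Set (VilenkinGroup p)) = 1)
    (i j : {k : ZMod p // k ≠ 0} × ℤ × shifts p) [Decidable (i = j)] :
    ∫ x, haarWavelet r j x * conj (haarWavelet r i x) ∂μ = if i = j then 1 else 0 := by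
  have hp0 : (p : ℝ) ≠ 0 := by simp [hp.out.ne_zero]
  split_ifs with hij
  · subst hij
    rw [integral_haarWavelet_mul_conj, mul_inv_cancel, Set.inter_self, ← Complex.ofReal_mul,
      Real.mul_self_sqrt (by positivity)]
    simp_rw [Dual.val_one]
    rw [setIntegral_const, measureReal_ball μ hμ, Complex.real_smul, mul_one,
      ← Complex.ofReal_mul, ← zpow_add₀ hp0, add_neg_cancel, zpow_zero, Complex.ofReal_one]
  · rcases lt_trichotomy i.2.1 j.2.1 with h | h | h
    · exact hr.integral_haarWavelet_of_lt μ h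
    · obtain ⟨⟨k, hk⟩, s, a⟩ := i
      obtain ⟨⟨k', hk'⟩, s', a'⟩ := j
      obtain rfl : s = s' := h
      rw [integral_haarWavelet_mul_conj]
      by_cases hkk : k' = k
      · subst hkk
        have ha : a ≠ a' := fun h => hij (by rw [h])
        rw [(disjoint_ball ha).inter_eq, setIntegral_empty, mul_zero]
      · rw [integral_inter_ball_eq_zero μ le_rfl, mul_zero]
        rwa [hr.pow_mul_inv_pow_mem_iff]
    · have h1 := congrArg conj (hr.integral_haarWavelet_of_lt μ h)
      rw [← integral_conj, map_zero] at h1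
      rw [← h1]
      refine integral_congr_ae (ae_of_all _ fun x => ?_)
      simp [mul_comm]

theorem inner_toLp_haarWavelet (hμ : μ (level p 0 : Set (VilenkinGroup p)) = 1)
    {f : VilenkinGroup p → ℂ} (hf : MemLp f 2 μ) (i : {k : ZMod p // k ≠ 0} × ℤ × shifts p) :
    inner ℂ ((memLp_haarWavelet μ hμ r i).toLp _) (hf.toLp f) =
      ∫ x, f x * conj (haarWavelet r i x) ∂μ := by
  rw [L2.inner_def]
  refine integral_congr_ae ?_
  filter_upwards [(memLp_haarWavelet μ hμ r i).coeFn_toLp, hf.coeFn_toLp] with x h1 h2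
  rw [h1, h2, RCLike.inner_apply]

/-- The Haar wavelets form an orthonormal basis. -/
theorem IsRademacher.hasSum_haarWavelet (hr : IsRademacher r)
    (hμ : μ (level p 0 : Set (VilenkinGroup p)) = 1)
    {f : VilenkinGroup p → ℂ} (hf : MemLp f 2 μ) :
    HasSum (fun i => ‖∫ x, f x * conj (haarWavelet r i x) ∂μ‖ ^ 2) (∫ x, ‖f x‖ ^ 2 ∂μ) := by
  classical
  set e : {k : ZMod p // k ≠ 0} × ℤ × shifts p → Lp ℂ 2 μ := fun i =>
    (memLp_haarWavelet μ hμ r i).toLp _ with he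
  have hon : Orthonormal ℂ e := by
    rw [orthonormal_iff_ite]
    intro i j
    rw [he]
    dsimp only
    rw [inner_toLp_haarWavelet μ hμ, hr.integral_haarWavelet μ hμ]
  -- Completeness: if all coefficients with `k ≠ 0` vanish, inversion on `ℤ/p` spreads each ball
  -- integral equally over the `p` parts, which forces `g = 0`.
  have hbot : (Submodule.span ℂ (Set.range e))ᗮ = ⊥ := by
    rw [Submodule.eq_bot_iff]
    intro g hg
    have hg0 : ∀ i, inner ℂ (e i) g = 0 := fun i =>
      (Submodule.mem_orthogonal _ _).1 hg _ (Submodule.subset_span ⟨i, rfl⟩)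
    have hgL : MemLp g 2 μ := Lp.memLp g
    have hcoef : ∀ (s : ℤ) (h : shifts p) (k : ZMod p), k ≠ 0 →
        ∫ x in ball s (h : VilenkinGroup p), g x * conj ((r s ^ k.val).val x) ∂μ = 0 := by
      intro s h k hk
      have h1 := hg0 (⟨k, hk⟩, s, h)
      rw [← Lp.toLp_coeFn g hgL, he] at h1
      dsimp only at h1
      rw [inner_toLp_haarWavelet μ hμ, integral_mul_conj_haarWavelet] at h1
      refine (mul_eq_zero.1 h1).resolve_left ?_
      rw [Complex.ofReal_eq_zero]
      exact (Real.sqrt_pos.2 (zpow_pos (by exact_mod_cast hp.out.pos) _)).ne'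
    have hball := setIntegral_ball_eq_zero μ hμ g fun s h d => by
      rw [← ZMod.sum_mul_pow_val (childVal_pow r s h) (hr.childVal_injective s h)
        (fun d => ∫ x in ball (s + 1) (shiftsEquiv p (d, h) : VilenkinGroup p), g x ∂μ) d]
      have h1 := fun m => hr.setIntegral_ball_eq_sum μ hμ hgL s h m 1
      simp only [mul_one, Dual.val_one, map_one] at h1
      simp_rw [← h1]
      rw [Finset.sum_eq_single 0]
      · simp
      · intro k _ hk
        rw [hcoef s h k hk, zero_mul]
      · simp
    exact (Lp.eq_zero_iff_ae_eq_zero).2 (eq_zero_of_setIntegral_ball_eq_zero μ hμ hgL hball)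
  have hsum := (HilbertBasis.mkOfOrthogonalEqBot hon hbot).hasSum_inner_mul_inner
    (hf.toLp f) (hf.toLp f)
  rw [HilbertBasis.coe_mkOfOrthogonalEqBot, L2.inner_def] at hsum
  have h1 : ∫ x, inner ℂ (hf.toLp f x) (hf.toLp f x) ∂μ = ((∫ x, ‖f x‖ ^ 2 ∂μ : ℝ) : ℂ) := by
    rw [← integral_complex_ofReal]
    refine integral_congr_ae ?_
    filter_upwards [hf.coeFn_toLp] with x hx
    rw [hx, RCLike.inner_apply, Complex.mul_conj']
    push_cast
    rfl
  rw [h1] at hsum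
  have h2 : (fun i => inner ℂ (hf.toLp f) (e i) * inner ℂ (e i) (hf.toLp f)) = fun i =>
      ((‖∫ x, f x * conj (haarWavelet r i x) ∂μ‖ ^ 2 : ℝ) : ℂ) := by
    funext i
    rw [← inner_conj_symm (hf.toLp f) (e i), he]
    dsimp only
    rw [inner_toLp_haarWavelet μ hμ, Complex.conj_mul']
    push_cast
    rfl
  rw [h2] at hsum
  exact_mod_cast hsum

theorem IsRademacher.tsum_energy (hr : IsRademacher r)
    (hμ : μ (level p 0 : Set (VilenkinGroup p)) = 1)
    {f : VilenkinGroup p → ℂ} (hf : MemLp f 2 μ) :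
    ∑ k : {k : ZMod p // k ≠ 0}, ∑' s : ℤ, energy μ f s (r s ^ k.1.val) =
      ENNReal.ofReal (∫ x, ‖f x‖ ^ 2 ∂μ) := by
  have h := hr.hasSum_haarWavelet μ hμ hf
  rw [← h.tsum_eq, ENNReal.ofReal_tsum_of_nonneg (fun _ => by positivity) h.summable,
    ENNReal.tsum_prod', tsum_fintype]
  refine Finset.sum_congr rfl fun k _ => ?_
  rw [ENNReal.tsum_prod']
  refine tsum_congr fun s => tsum_congr fun h => ?_
  rw [integral_mul_conj_haarWavelet, norm_mul, mul_pow, Complex.norm_real, Real.norm_eq_abs, sq_abs,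
    Real.sq_sqrt (by positivity)]

end

end VilenkinGroup

/-! ### The tight wavelet frame -/

namespace VilenkinGroup

variable {p : ℕ}

/-- `center (-M)` forgets the last `M` digits, so each fibre has `p^M` elements. -/
theorem tsum_center [NeZero p] (M : ℕ) (g : shifts p → ENNReal) :
    ∑' h : shifts p, g (center (-(M : ℤ)) (h : VilenkinGroup p)) =
      (p : ENNReal) ^ M * ∑' h, g h := by
  induction M generalizing g with
  | zero =>
    rw [pow_zero, one_mul]
    refine tsum_congr fun h => congrArg g (mem_ball_shifts_iff.1 ?_)
    rw [mem_ball_iff]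
    simp
  | succ M ih =>
    have h1 : ∀ h : shifts p, center (-((M + 1 : ℕ) : ℤ)) (h : VilenkinGroup p) =
        center (-1) (center (-(M : ℤ)) (h : VilenkinGroup p) : VilenkinGroup p) := fun h => by
      rw [center_center _ _ (by omega)]
      congr 1
      push_cast
      ring
    simp_rw [h1]
    rw [ih fun h => g (center (-1) (h : VilenkinGroup p)), ← (shiftsEquiv p).tsum_eq]
    simp_rw [center_shiftsEquiv]
    rw [ENNReal.tsum_prod', tsum_fintype]
    dsimp only
    rw [Finset.sum_const, Finset.card_univ, ZMod.card,
      nsmul_eq_mul, pow_succ, mul_assoc]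

theorem dilation_sub_mem_ball_iff {n m : ℤ} (_ : m ≤ 0) (h : shifts p) (x : VilenkinGroup p) :
    dilation p n x - h ∈ ball m (0 : VilenkinGroup p) ↔
      x ∈ ball (n + m) (center m (h : VilenkinGroup p) : VilenkinGroup p) := by
  rw [mem_ball_iff, mem_ball_iff]
  simp only [coord_sub, coord_dilation, coord_zero, sub_eq_zero, center, coord_truncate]
  constructor
  · intro H k hk
    rw [if_pos (by omega), ← sub_add_cancel k n, H (k - n) (by omega)]
    congr 1
    ring
  · intro H k hk
    rw [H (k + n) (by omega), if_pos (by omega)]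
    congr 1
    ring

/-- The shift `h` enters only through the ball and the phase `η(h)`; the constants are `p^n p^{2m} =
p^m p^{n+m}`. -/
theorem norm_integral_mul_conj_wavelet [NeZero p] (μ : Measure (VilenkinGroup p))
    (f : VilenkinGroup p → ℂ) (n : ℤ) {m : ℤ} (hm : m ≤ 0) (η : Dual p) (h : shifts p) :
    ‖∫ x, f x * conj (wavelet (levelChar m η) n (h : VilenkinGroup p) x) ∂μ‖ ^ 2 =
      (p : ℝ) ^ m * ((p : ℝ) ^ (n + m) *
        ‖∫ x in ball (n + m) (center m (h : VilenkinGroup p) : VilenkinGroup p),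
          f x * conj ((Dual.dilate n η).val x) ∂μ‖ ^ 2) := by
  have hp0 : (p : ℝ) ≠ 0 := by simp [NeZero.ne p]
  have h1 : ∀ x, f x * conj (wavelet (levelChar m η) n (h : VilenkinGroup p) x) =
      (ball (n + m) (center m (h : VilenkinGroup p) : VilenkinGroup p)).indicator (fun x =>
        ((((p : ℝ) ^ ((n : ℝ) / 2) : ℝ) : ℂ) * (p : ℂ) ^ m * η.val h) *
          (f x * conj ((Dual.dilate n η).val x))) x := by
    intro x
    rw [wavelet, levelChar]
    by_cases hx : dilation p n x - h ∈ ball m (0 : VilenkinGroup p)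
    · rw [Set.indicator_of_mem hx,
        Set.indicator_of_mem ((dilation_sub_mem_ball_iff hm h x).1 hx), Dual.val_sub,
        Dual.val_dilate]
      simp only [map_mul, Complex.conj_ofReal, Complex.conj_conj, map_zpow₀, map_natCast]
      ring
    · rw [Set.indicator_of_notMem hx,
        Set.indicator_of_notMem (mt (dilation_sub_mem_ball_iff hm h x).2 hx), mul_zero, map_zero,
        mul_zero]
  simp_rw [h1]
  rw [integral_indicator (measurableSet_ball _ _), integral_const_mul, norm_mul, norm_mul, norm_mul,
    Dual.norm_val, Complex.norm_real, norm_zpow, Complex.norm_natCast, mul_one, mul_pow, mul_pow,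
    Real.norm_eq_abs, sq_abs, ← Real.rpow_natCast, ← Real.rpow_mul (by positivity), zpow_add₀ hp0]
  norm_num
  ring

/-- With `m = -M`, each ball is hit by `p^M` shifts, which cancels the factor `p^m`. -/
theorem tsum_norm_integral_mul_conj_wavelet [NeZero p] (μ : Measure (VilenkinGroup p))
    (f : VilenkinGroup p → ℂ) (n : ℤ) {m : ℤ} (hm : m ≤ 0) (η : Dual p) :
    ∑' h : shifts p, ENNReal.ofReal
      (‖∫ x, f x * conj (wavelet (levelChar m η) n (h : VilenkinGroup p) x) ∂μ‖ ^ 2) =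
      energy μ f (n + m) (Dual.dilate n η) := by
  obtain ⟨M, rfl⟩ : ∃ M : ℕ, m = -M := ⟨m.natAbs, by omega⟩
  have hp0 : (p : ℝ) ≠ 0 := by simp [NeZero.ne p]
  have hpE : (p : ENNReal) = ENNReal.ofReal p := (ENNReal.ofReal_natCast p).symm
  simp_rw [norm_integral_mul_conj_wavelet μ f n hm]
  rw [tsum_center M fun h' : shifts p => ENNReal.ofReal
      ((p : ℝ) ^ (-(M : ℤ)) * ((p : ℝ) ^ (n + -(M : ℤ)) *
        ‖∫ x in ball (n + -(M : ℤ)) (h' : VilenkinGroup p),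
          f x * conj ((Dual.dilate n η).val x) ∂μ‖ ^ 2)), ← ENNReal.tsum_mul_left, energy]
  refine tsum_congr fun h => ?_
  rw [hpE, ← ENNReal.ofReal_pow (by positivity), ← ENNReal.ofReal_mul (by positivity), ← mul_assoc,
    zpow_neg, zpow_natCast, mul_inv_cancel₀ (pow_ne_zero _ hp0), one_mul]

theorem hasSum_of_tsum_ofReal_eq {ι : Type*} {f : ι → ℝ} (hf : ∀ i, 0 ≤ f i) {a : ℝ} (ha : 0 ≤ a)
    (h : ∑' i, ENNReal.ofReal (f i) = ENNReal.ofReal a) : HasSum f a := by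
  have h1 := ENNReal.hasSum_toReal (f := fun i => ENNReal.ofReal (f i))
    (by rw [h]; exact ENNReal.ofReal_ne_top)
  rw [← ENNReal.tsum_toReal_eq fun _ => ENNReal.ofReal_ne_top, h, ENNReal.toReal_ofReal ha] at h1
  simpa only [ENNReal.toReal_ofReal (hf _)] using h1

/-- The functions whose Fourier transforms are the indicators of the sets `waveletCoset`. -/
noncomputable def frameGenerator (N : ℕ) (r : ℤ → Dual p) (J₁ J₂ : Finset (ZMod p)) :
    J₁ ⊕ ZMod p × J₂ → VilenkinGroup p → ℂ
  | Sum.inl k => levelChar (-(N : ℤ) + 1) (r (-(N : ℤ) + 1) ^ (k : ZMod p).val)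
  | Sum.inr (j, k) =>
      levelChar (-(N : ℤ)) (r (-(N : ℤ)) ^ j.val * r (-(N : ℤ) + 1) ^ (k : ZMod p).val)

section

variable [hp : Fact p.Prime] (μ : Measure (VilenkinGroup p)) [μ.IsAddHaarMeasure]

theorem IsRademacher.generatesTightWaveletFrame
    (hμ : μ (level p 0 : Set (VilenkinGroup p)) = 1) {r : ℤ → Dual p} (hr : IsRademacher r)
    {N : ℕ} (hN : 1 ≤ N) {J₁ J₂ : Finset (ZMod p)} (hd : Disjoint J₁ J₂)
    (hJ : ∀ a : ZMod p, a ∈ J₁ ∪ J₂ ↔ a ≠ 0) :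
    GeneratesTightWaveletFrame μ (frameGenerator N r J₁ J₂) := by
  refine ⟨?_, fun f hf => hasSum_of_tsum_ofReal_eq (fun _ => by positivity)
    (integral_nonneg fun _ => by positivity) ?_⟩
  · rintro (k | ⟨j, k⟩)
    · exact memLp_levelChar μ hμ _ _
    · exact memLp_levelChar μ hμ _ _
  set W : ZMod p → ENNReal := fun k => ∑' s : ℤ, energy μ f s (r s ^ k.val) with hW
  -- Summing over all `n ∈ ℤ` absorbs the fixed shift of the radius.
  have hshift : ∀ k : ZMod p,
      ∑' n : ℤ, energy μ f (n + (-(N : ℤ) + 1)) (r (n + (-(N : ℤ) + 1)) ^ k.val) = W k := fun k =>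
    (Equiv.addRight (-(N : ℤ) + 1)).tsum_eq fun s => energy μ f s (r s ^ k.val)
  have hdil : ∀ (n a : ℤ) (k : ℕ), Dual.dilate n (r a ^ k) = r (n + a) ^ k := fun n a k => by
    rw [← Dual.dilateHom_apply, map_pow, Dual.dilateHom_apply, hr.dilate_eq, add_comm]
  have h1 : ∀ k : J₁, ∑' n : ℤ, ∑' h : shifts p, ENNReal.ofReal
      (‖∫ x, f x * conj (wavelet (frameGenerator N r J₁ J₂ (Sum.inl k)) n
        (h : VilenkinGroup p) x) ∂μ‖ ^ 2) = W k := by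
    intro k
    simp_rw [frameGenerator]
    rw [← hshift]
    refine tsum_congr fun n => ?_
    rw [tsum_norm_integral_mul_conj_wavelet μ f n (by omega), hdil]
  have h2 : ∀ k : J₂, ∑ j : ZMod p, ∑' n : ℤ, ∑' h : shifts p, ENNReal.ofReal
      (‖∫ x, f x * conj (wavelet (frameGenerator N r J₁ J₂ (Sum.inr (j, k))) n
        (h : VilenkinGroup p) x) ∂μ‖ ^ 2) = W k := by
    intro k
    simp_rw [frameGenerator]
    rw [← hshift, ← Summable.tsum_finsetSum fun _ _ => ENNReal.summable]
    refine tsum_congr fun n => ?_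
    simp_rw [tsum_norm_integral_mul_conj_wavelet μ f n (by omega : -(N : ℤ) ≤ 0), Dual.dilate_mul,
      hdil]
    -- The sum over `j` passes from radius `n - N` to `n - N + 1`, the one used for `J₁`.
    rw [hr.sum_energy μ hμ hf, add_assoc]
  rw [ENNReal.tsum_prod', tsum_fintype, Fintype.sum_sum_type]
  simp_rw [ENNReal.tsum_prod']
  rw [Finset.sum_congr rfl fun k _ => h1 k, Fintype.sum_prod_type_right,
    Finset.sum_congr rfl fun k _ => h2 k, ← hr.tsum_energy μ hμ hf,
    Finset.sum_coe_sort J₁ W, Finset.sum_coe_sort J₂ W, ← Finset.sum_union hd]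
  exact Finset.sum_subtype _ hJ W

end

/-- The exponent `-N+2` is what puts `χ𝒜^{-1}` into `G_{-N+1}^⊥`, where `φ̂ = 1`. -/
theorem waveletCoset_subset (N : ℕ) {r : ℤ → Dual p} (hr : IsRademacher r)
    (J₁ J₂ : Finset (ZMod p)) (i : J₁ ⊕ ZMod p × J₂) :
    waveletCoset N r J₁ J₂ i ⊆ Dual.annihilator p (-(N : ℤ) + 2) := by
  intro χ hχ
  have h1 : ∀ k : ℕ, r (-(N : ℤ) + 1) ^ k ∈ Dual.annihilator p (-(N : ℤ) + 2) := fun k =>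
    pow_mem (Dual.annihilator_mono (by omega) (hr.mem _)) k
  have h2 : ∀ k : ℕ, r (-(N : ℤ)) ^ k ∈ Dual.annihilator p (-(N : ℤ) + 2) := fun k =>
    pow_mem (Dual.annihilator_mono (by omega) (hr.mem _)) k
  rcases i with k | ⟨j, k⟩
  · have h3 : χ * _ ∈ Dual.annihilator p (-(N : ℤ) + 2) := Dual.annihilator_mono (by omega) hχ
    exact (Subgroup.mul_mem_cancel_right _ (inv_mem (h1 _))).1 h3
  · have h3 : χ * _ ∈ Dual.annihilator p (-(N : ℤ) + 2) := Dual.annihilator_mono (by omega) hχ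
    exact (Subgroup.mul_mem_cancel_right _ (inv_mem (mul_mem (h2 _) (h1 _)))).1 h3

end VilenkinGroup

theorem theorem3p2 (p : ℕ) [hp : Fact p.Prime] (N : ℕ) (hN : 1 ≤ N)
    (μ : Measure (VilenkinGroup p)) [μ.IsAddHaarMeasure]
    (hμ : μ (VilenkinGroup.level p 0 : Set (VilenkinGroup p)) = 1)
    (ν : Measure (VilenkinGroup.Dual p)) [ν.IsHaarMeasure]
    (hν : ν (VilenkinGroup.Dual.annihilator p 0 : Set (VilenkinGroup.Dual p)) = 1)
    (r : ℤ → VilenkinGroup.Dual p) (hr : VilenkinGroup.IsRademacher r)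
    (T : LabelledTree.{u} p) (hT : T.IsValid N)
    (hTN : T.label '' {v | T.level v = N} = {a | a ≠ 0}) :
    (∃ φ : VilenkinGroup p → ℂ, MemLp φ 2 μ ∧
      VilenkinGroup.IsFourierTransform μ ν φ (T.phiHat N r)) ∧
      ∀ J₁ J₂ : Finset (ZMod p), Disjoint J₁ J₂ → (∀ a : ZMod p, a ∈ J₁ ∪ J₂ ↔ a ≠ 0) →
        ∃ ψ : J₁ ⊕ ZMod p × J₂ → VilenkinGroup p → ℂ,
          (∀ i, VilenkinGroup.IsFourierTransform μ ν (ψ i) (fun χ =>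
            (VilenkinGroup.waveletCoset N r J₁ J₂ i).indicator (fun _ => (1 : ℂ)) χ *
              T.phiHat N r (VilenkinGroup.Dual.dilate (-1) χ))) ∧
          VilenkinGroup.GeneratesTightWaveletFrame μ ψ := by
  constructor
  · obtain ⟨M, hM⟩ := hT.exists_level_le
    -- The support lies in `G_{M+1}^⊥`, and `M + 1 = -N + (N + M + 1)`.
    refine VilenkinGroup.exists_isFourierTransform μ ν hμ hν hr (by omega : -(N : ℤ) ≤ 0)
      (N + M + 1) (fun χ η hη => LabelledTree.phiHat_mul_of_mem hr hη) fun χ hχ => ?_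
    have h := LabelledTree.IsValid.mem_annihilator_of_phiHat_ne_zero hr hT hN hM hχ
    convert h using 2
    push_cast
    ring
  · intro J₁ J₂ hd hJ
    refine ⟨VilenkinGroup.frameGenerator N r J₁ J₂, fun i => ?_,
      hr.generatesTightWaveletFrame μ hμ hN hd hJ⟩
    have h1 : (fun χ => (VilenkinGroup.waveletCoset N r J₁ J₂ i).indicator (fun _ => (1 : ℂ)) χ *
        T.phiHat N r (VilenkinGroup.Dual.dilate (-1) χ)) =
          (VilenkinGroup.waveletCoset N r J₁ J₂ i).indicator fun _ => (1 : ℂ) := by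
      funext χ
      by_cases hχ : χ ∈ VilenkinGroup.waveletCoset N r J₁ J₂ i
      · rw [LabelledTree.IsValid.phiHat_eq_one hr hT hTN, mul_one]
        rw [VilenkinGroup.Dual.dilate_mem_annihilator]
        have h := VilenkinGroup.waveletCoset_subset N hr J₁ J₂ i hχ
        rwa [show -(N : ℤ) + 2 = -(N : ℤ) + 1 - -1 by ring] at h
      · rw [Set.indicator_of_notMem hχ, zero_mul]
    rw [h1]
    rcases i with k | ⟨j, k⟩
    · exact VilenkinGroup.isFourierTransform_levelChar μ ν hμ hν (by omega) _
    · exact VilenkinGroup.isFourierTransform_levelChar μ ν hμ hν (by omega) _
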